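/- Conventions. Let $G$ be a topological Abelian group. An exponential on $G$ is a continuous homomorphism of $G$ into the multiplicative group $\mathbb{C}\setminus\{0\}$; a polynomial on $G$ is a function $x\mapsto P(a_1(x),\dots,a_s(x))$ with $P$ a complex polynomial in $s$ variables and $a_1,\dots,a_s:G\to\mathbb{C}$ continuous additive functions; an exponential polynomial is a finite sum $\sum_{i=1}^N p_ie_i$ with polynomials $p_i$ and exponentials $e_i$, and this form is called reduced if all $p_i$ are nonzero and the $e_i$ are pairwise distinct. For $\varphi:G\to\mathbb{C}$ and $y\in G$ put $\Delta_{\varphi;y}f(x)=f(x+y)-\varphi(y)f(x)$ for functions $f$ on $G$, and $\Delta_{\varphi;y}u=\tau_yu-\varphi(y)u$ for distributions $u$ on $G=\mathbb{R}^d$, where $(\tau_yu)(\psi)=u(\psi(\cdot-y))$; powers and products of such operators are compositions. Natural numbers include $0$. Theorem. Suppose that one of the following holds: (1) $G$ is an Abelian group (with the discrete topology) generated by $g_1,\dots,g_t$, and $f:G\to\mathbb{C}$ is a nonzero function; (2) $G$ is a topological Abelian group in which $g_1,\dots,g_t$ generate a dense subgroup, and $f:G\to\mathbb{C}$ is a nonzero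 continuous function; (3) $G=\mathbb{R}^d$, $g_1,\dots,g_t$ generate a dense subgroup of $G$, and $f$ is a nonzero complex valued distribution on $\mathbb{R}^d$. Let $n_{k,i}$ ($1\le k\le r$, $1\le i\le t$) be natural numbers and let $\varphi_1,\dots,\varphi_r:G\to\mathbb{C}$ be functions such that $$\Delta_{\varphi_1;g_{i_1}}^{n_{1,i_1}+1}\Delta_{\varphi_2;g_{i_2}}^{n_{2,i_2}+1}\cdots\Delta_{\varphi_r;g_{i_r}}^{n_{r,i_r}+1}f=0\qquad(*)$$ on $G$ for all $1\le i_1,\dots,i_r\le t$. Then: (i) $f$ is an exponential polynomial; it has a reduced form $f=\sum_{i=1}^Np_ie_i$ (in case (3), $f$ is the distribution given by integration against this function). (ii) Let $H$ be the subgroup generated by $g_1,\dots,g_t$, and suppose that $\varphi_1,\dots,\varphi_r$ form a minimal set for $(*)$, that is: either $r=1$ and $f|_H\neq0$, or $r\ge2$ and for each $k$ there are indices $a_j\in\{1,\dots,t\}$ ($j\ne k$) such that the product of the operators $\Delta_{\varphi_j;g_{a_j}}^{n_{j,a_j}+1}$ over $j\neq k$, applied to $f$, is nonzero at some point of $H$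 (in case (3): "is a nonzero distribution", and for $r=1$: $f\ne0$). Then there exist exponentials $m_1,\dots,m_r$ on $G$ with $m_k(g_i)=\varphi_k(g_i)$ for all $1\le i\le t$, $1\le k\le r$. Moreover, if $n_1,\dots,n_r$ are natural numbers such that $$\Delta_{\varphi_1;y_1}^{n_1+1}\Delta_{\varphi_2;y_2}^{n_2+1}\cdots\Delta_{\varphi_r;y_r}^{n_r+1}f=0$$ for all $y_1,\dots,y_r\in G$, then for every reduced form $f=\sum_{i=1}^Np_ie_i$ we have $N\le r$ and, after a suitable renumbering of $m_1,\dots,m_r$, $e_k(g_i)=m_k(g_i)$ for all $1\le i\le t$, $1\le k\le N$; and if $n_k\le n_{k,i}$ for all $k$ and $i$ (for instance $n_{k,i}=n_k$), then each $\varphi_k$ is an exponential. -/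

import Mathlib

open scoped Distributions

/-! ### Exponentials, polynomials, exponential polynomials on a topological Abelian group -/

/-- An exponential: a continuous homomorphism into the multiplicative group of nonzero complex
numbers. -/
def IsExponential {G : Type*} [AddCommGroup G] [TopologicalSpace G] (e : G → ℂ) : Prop :=
  Continuous e ∧ (∀ x, e x ≠ 0) ∧ ∀ x y, e (x + y) = e x * e y

/-- A polynomial: an ordinary polynomial in finitely many continuous additive functions. -/
def IsPolynomialFun {G : Type*} [AddCommGroup G] [TopologicalSpace G] (p : G → ℂ) : Prop :=
  ∃ (s : ℕ) (a : Fin s → G →+ ℂ) (P : MvPolynomial (Fin s) ℂ),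
    (∀ j, Continuous (a j)) ∧ ∀ x, p x = MvPolynomial.eval (fun j => a j x) P

/-- The data of a reduced exponential polynomial `∑ i, p i * e i`: nonzero polynomials `p i` and
pairwise distinct exponentials `e i`. -/
structure IsReducedForm {G : Type*} [AddCommGroup G] [TopologicalSpace G] {N : ℕ}
    (p e : Fin N → G → ℂ) : Prop where
  polynomial : ∀ i, IsPolynomialFun (p i)
  ne_zero : ∀ i, p i ≠ 0
  exponential : ∀ i, IsExponential (e i)
  injective : Function.Injective e

/-! ### Translations of functions and of distributions -/

/-- `(τ_y f)(x) = f (x + y)` on complex valued functions. -/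
def translateFun {G : Type*} [AddCommGroup G] (y : G) : Module.End ℂ (G → ℂ) where
  toFun f := fun x => f (x + y)
  map_add' _ _ := rfl
  map_smul' _ _ := rfl

/-- `ℝ^d`. -/
abbrev RSpace (d : ℕ) : Type := EuclideanSpace ℝ (Fin d)

/-- Complex valued (Schwartz) distributions on `ℝ^d`. -/
abbrev Distr (d : ℕ) : Type := 𝓓'((⊤ : TopologicalSpace.Opens (RSpace d)), ℂ)

/-- Test functions on `ℝ^d`. -/
abbrev Test (d : ℕ) : Type := 𝓓((⊤ : TopologicalSpace.Opens (RSpace d)), ℝ)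

/-- The translate `x ↦ ψ (x + y)` of a test function. -/
noncomputable def translateTestFun {d : ℕ} (y : RSpace d) (ψ : Test d) : Test d where
  toFun := fun x => ψ (x + y)
  contDiff' := ψ.contDiff.comp (contDiff_id.add contDiff_const)
  hasCompactSupport' := ψ.hasCompactSupport.comp_homeomorph (Homeomorph.addRight y)
  tsupport_subset' := fun _ _ => trivial

/-- Translation of test functions supported in a fixed compact set is continuous. -/
noncomputable def translateSupportedIn {d : ℕ} (y : RSpace d)
    (K : TopologicalSpace.Compacts (RSpace d)) :
    𝓓^{⊤}_{K}(RSpace d, ℝ) →L[ℝ]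
      𝓓^{⊤}_{K.map (fun x => x - y) (by fun_prop)}(RSpace d, ℝ) :=
  ContDiffMapSupportedIn.mkCLM ℝ (fun f x => f (x + y))
    (fun _ _ _ => rfl) (fun _ _ _ => rfl)
    (fun f => f.contDiff.comp (contDiff_id.add contDiff_const))
    (fun f x hx => f.zero_on_compl (fun h => hx ⟨x + y, h, by simp⟩))
    (fun i _ => ⟨{i}, 1, zero_le_one, fun f x _ => by
      rw [iteratedFDeriv_comp_add_right]
      simpa using ContDiffMapSupportedIn.norm_iteratedFDeriv_apply_le_seminorm_top ℝ⟩)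

/-- `(τ_y ψ)(x) = ψ (x + y)` on test functions, as a continuous linear map. -/
noncomputable def translateTest {d : ℕ} (y : RSpace d) : Test d →L[ℝ] Test d :=
  TestFunction.limitCLM ℝ (translateTestFun y)
    (fun K _ => (TestFunction.ofSupportedInCLM ℝ (Set.subset_univ _)).comp
      (translateSupportedIn y K))
    (fun _ _ _ => rfl)

/-- `(τ_y u)(ψ) = u (τ_{-y} ψ)` on distributions. -/
noncomputable def translateDistr {d : ℕ} (y : RSpace d) : Module.End ℂ (Distr d) where
  toFun u := (translateTest (-y)).precompCompactConvergenceCLM ℂ u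
  map_add' _ _ := rfl
  map_smul' _ _ := rfl

/-- The distribution `u` is (given by integration against) the function `F`. -/
def IsGivenBy {d : ℕ} (u : Distr d) (F : RSpace d → ℂ) : Prop :=
  MeasureTheory.LocallyIntegrable F ∧ ∀ ψ : Test d, u ψ = ∫ x, (ψ x : ℂ) * F x

/-! ### Modified difference operators

They are defined for any family `τ` of translation operators, so that the same definition serves
functions (`translateFun`) and distributions (`translateDistr`). -/

/-- The modified difference operator `Δ_{φ;y} = τ_y - φ(y) τ_0`. -/
def modDiff {G E : Type*} [AddCommGroup E] [Module ℂ E] (τ : G → Module.End ℂ E)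
    (φ : G → ℂ) (y : G) : Module.End ℂ E :=
  τ y - φ y • 1

/-- The composition `∏_{k ∈ l} Δ_{φ_k;y_k}^{n_k+1}`, in the order of the list `l`. -/
def mixedDiff {G E : Type*} [AddCommGroup E] [Module ℂ E] (τ : G → Module.End ℂ E) {r : ℕ}
    (φ : Fin r → G → ℂ) (n : Fin r → ℕ) (y : Fin r → G) (l : List (Fin r)) : Module.End ℂ E :=
  (l.map fun k => modDiff τ (φ k) (y k) ^ (n k + 1)).prod

/-- The operator `Δ_{φ_1;g_{i_1}}^{n_{1,i_1}+1} ⋯ Δ_{φ_r;g_{i_r}}^{n_{r,i_r}+1}`. -/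
def nodeDiff {G E : Type*} [AddCommGroup E] [Module ℂ E] (τ : G → Module.End ℂ E) {r t : ℕ}
    (g : Fin t → G) (n : Fin r → Fin t → ℕ) (φ : Fin r → G → ℂ) (i : Fin r → Fin t) :
    Module.End ℂ E :=
  mixedDiff τ φ (fun k => n k (i k)) (fun k => g (i k)) (List.finRange r)

/-- The same operator with the `k`-th factor omitted. -/
def nodeDiffOmit {G E : Type*} [AddCommGroup E] [Module ℂ E] (τ : G → Module.End ℂ E) {r t : ℕ}
    (g : Fin t → G) (n : Fin r → Fin t → ℕ) (φ : Fin r → G → ℂ) (k : Fin r) (i : Fin r → Fin t) :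
    Module.End ℂ E :=
  mixedDiff τ φ (fun j => n j (i j)) (fun j => g (i j)) ((List.finRange r).filter (· ≠ k))

/-- The functions `φ_k` form a minimal set for the mixed equation satisfied by the function `f`;
all conditions are tested on the subgroup generated by the nodes. -/
def IsMinimalSet {G : Type*} [AddCommGroup G] {r t : ℕ} (g : Fin t → G) (n : Fin r → Fin t → ℕ)
    (φ : Fin r → G → ℂ) (f : G → ℂ) : Prop :=
  (∀ i : Fin r → Fin t, ∀ x ∈ AddSubgroup.closure (Set.range g),
    nodeDiff translateFun g n φ i f x = 0) ∧
  ((r = 1 ∧ ∃ x ∈ AddSubgroup.closure (Set.range g), f x ≠ 0) ∨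
   (2 ≤ r ∧ ∀ k : Fin r, ∃ a : Fin r → Fin t, ∃ x₀ ∈ AddSubgroup.closure (Set.range g),
      nodeDiffOmit translateFun g n φ k a f x₀ ≠ 0))

/-- The functions `φ_k` form a minimal set for the mixed equation satisfied by the
distribution `u`. -/
def IsMinimalSetDistr {d r t : ℕ} (g : Fin t → RSpace d) (n : Fin r → Fin t → ℕ)
    (φ : Fin r → RSpace d → ℂ) (u : Distr d) : Prop :=
  (∀ i : Fin r → Fin t, nodeDiff translateDistr g n φ i u = 0) ∧
  ((r = 1 ∧ u ≠ 0) ∨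
   (2 ≤ r ∧ ∀ k : Fin r, ∃ a : Fin r → Fin t, nodeDiffOmit translateDistr g n φ k a u ≠ 0))

/-! Let the group algebra ℂ[G] act on f by translations and divide by the annihilator of f. The
resulting commutative algebra Q (`OrbitAlgebra`) is isomorphic as a module to the span of the
translates of f, and the classes of group elements give a homomorphism π (`point`) into its units.
Equation (*) with all indices equal makes each π(g_i) integral over ℂ, so the translates of f along
the subgroup of the nodes span a finite dimensional space. Such a space is weakly closed, and
density with weak continuity gives dim Q < ∞ (`finiteDimensional_of_nodeDiff`).

A finite dimensional commutative ℂ-algebra splits into local parts, one for each character χ. On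
such a part π is χ∘π times a continuous unipotent homomorphism, whose coordinates are polynomials
(`coordinatesIn_polyFun_of_sub_one_mem`). Hence all matrix coefficients of π are exponential
polynomials (`exists_exponential_decomposition`), and f is one of them.

For (ii), minimality makes the product q of the factors other than the k-th nonzero in Q, for
suitable nodes, while q(π(g_i) − φ_k(g_i))^{n_{k,i}+1} = 0 for all i. A character killing the
annihilator of q sends π(g_i) to φ_k(g_i), and its composition with π is m_k. Each exponential of a
reduced form also comes from a character of Q (`IsReducedForm.exists_character`); applied to (*),
this character must agree with a single φ_k at all nodes.

For a distribution the same argument gives dim Q < ∞. Regularization by test functions then shows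
that the distribution is a continuous function (`exists_continuous_eq_integral`), to which the
function case applies. -/

/-! ### Polynomials as a subalgebra of the functions on the group. -/

section PolynomialFunctions

variable {G : Type*} [AddCommGroup G] [TopologicalSpace G]

/-- The algebra generated by the continuous additive functions. -/
def polyFun (G : Type*) [AddCommGroup G] [TopologicalSpace G] : Subalgebra ℂ (G → ℂ) :=
  Algebra.adjoin ℂ {a | ∃ α : G →+ ℂ, Continuous α ∧ a = α}

/-- The subalgebra form gives closure under sums and products for free. In the converse direction,
an element of an adjoined algebra involves only finitely many of the generators. -/
theorem isPolynomialFun_iff_mem_polyFun {p : G → ℂ} : IsPolynomialFun p ↔ p ∈ polyFun G := by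
  constructor
  · rintro ⟨s, a, P, ha, hP⟩
    have : p = MvPolynomial.aeval (fun j => (a j : G → ℂ)) P := by
      funext x
      have := MvPolynomial.comp_aeval_apply (fun j => (a j : G → ℂ))
        (Pi.evalAlgHom ℂ (fun _ : G => ℂ) x) P
      simp only [Pi.evalAlgHom_apply] at this
      rw [this, hP, MvPolynomial.aeval_eq_eval]
    rw [this]
    refine Subalgebra.mvPolynomial_aeval_coe (polyFun G)
      (fun j => ⟨a j, Algebra.subset_adjoin ⟨a j, ha j, rfl⟩⟩) P ▸ Subtype.coe_prop _
  · intro hp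
    rw [polyFun, Algebra.adjoin_eq_range] at hp
    obtain ⟨P, rfl⟩ := hp
    obtain ⟨s, a, -, q, rfl⟩ := MvPolynomial.exists_fin_rename P
    choose α hα hα' using fun j => (a j).2
    refine ⟨s, α, q, hα, fun x => ?_⟩
    have := MvPolynomial.comp_aeval_apply (fun j => ((a j : G → ℂ)))
        (Pi.evalAlgHom ℂ (fun _ : G => ℂ) x) q
    simp only [Pi.evalAlgHom_apply] at this
    have h : (MvPolynomial.aeval Subtype.val).toRingHom (MvPolynomial.rename a q) =
        MvPolynomial.aeval (fun j => (a j : G → ℂ)) q := MvPolynomial.aeval_rename _ _ _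
    rw [h, this, MvPolynomial.aeval_eq_eval]
    simp only [hα']

theorem addMonoidHom_mem_polyFun {a : G →+ ℂ} (ha : Continuous a) : (a : G → ℂ) ∈ polyFun G :=
  Algebra.subset_adjoin ⟨a, ha, rfl⟩

/-- The algebra of continuous complex valued functions, as functions. -/
def contFun (G : Type*) [TopologicalSpace G] : Subalgebra ℂ (G → ℂ) where
  carrier := {f | Continuous f}
  mul_mem' hf hg := Continuous.mul hf hg
  add_mem' hf hg := Continuous.add hf hg
  algebraMap_mem' _ := continuous_const

theorem polyFun_le_contFun : polyFun G ≤ contFun G := by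
  refine Algebra.adjoin_le ?_
  rintro _ ⟨α, hα, rfl⟩
  exact hα

theorem continuous_of_mem_polyFun {p : G → ℂ} (hp : p ∈ polyFun G) : Continuous p :=
  polyFun_le_contFun hp

end PolynomialFunctions

/-! ### Vector valued functions with coordinates in a given function algebra. -/

section CoordinatesIn

variable {G B : Type*} [CommRing B] [Algebra ℂ B]

/-- All coordinates of the vector valued function `F` lie in the algebra `S` of scalar functions. -/
def CoordinatesIn (S : Subalgebra ℂ (G → ℂ)) (F : G → B) : Prop :=
  ∀ ℓ : B →ₗ[ℂ] ℂ, (fun x => ℓ (F x)) ∈ S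

namespace CoordinatesIn

variable {S : Subalgebra ℂ (G → ℂ)} {F F' : G → B}

theorem const (b : B) : CoordinatesIn S (fun _ : G => b) := fun ℓ => S.algebraMap_mem (ℓ b)

theorem smul (c : ℂ) (hF : CoordinatesIn S F) : CoordinatesIn S (fun x => c • F x) := fun ℓ => by
  simp only [map_smul]
  exact S.smul_mem (hF ℓ) c

theorem sub (hF : CoordinatesIn S F) (hF' : CoordinatesIn S F') :
    CoordinatesIn S (fun x => F x - F' x) := fun ℓ => by
  simp only [map_sub]
  exact S.sub_mem (hF ℓ) (hF' ℓ)

theorem sum {ι : Type*} (s : Finset ι) {F : ι → G → B} (hF : ∀ i, CoordinatesIn S (F i)) :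
    CoordinatesIn S (fun x => ∑ i ∈ s, F i x) := fun ℓ => by
  simp only [map_sum]
  convert S.sum_mem (t := s) (f := fun i x => ℓ (F i x)) fun i _ => hF i ℓ using 1
  ext x
  simp

/-- In a basis, multiplication is bilinear with constant structure coefficients. -/
theorem mul [FiniteDimensional ℂ B] (hF : CoordinatesIn S F) (hF' : CoordinatesIn S F') :
    CoordinatesIn S (fun x => F x * F' x) := fun ℓ => by
  let b := Module.finBasis ℂ B
  have h : (fun x => ℓ (F x * F' x)) =
      ∑ i, ∑ j, ℓ (b i * b j) • ((fun x => b.coord i (F x)) * fun x => b.coord j (F' x)) := by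
    funext x
    conv_lhs => rw [← b.sum_repr (F x), ← b.sum_repr (F' x)]
    simp only [Finset.sum_mul_sum, smul_mul_smul_comm, map_sum, map_smul, Finset.sum_apply,
      Pi.smul_apply, Pi.mul_apply, Module.Basis.coord_apply, smul_eq_mul]
    exact Finset.sum_congr rfl fun i _ => Finset.sum_congr rfl fun j _ => by ring
  rw [h]
  exact S.sum_mem fun i _ => S.sum_mem fun j _ => S.smul_mem (S.mul_mem (hF _) (hF' _)) _

theorem pow [FiniteDimensional ℂ B] (hF : CoordinatesIn S F) (n : ℕ) :
    CoordinatesIn S (fun x => F x ^ n) := by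
  induction n with
  | zero => simpa using const 1
  | succ n ih => simpa only [pow_succ] using ih.mul hF

end CoordinatesIn

end CoordinatesIn

/-! ### Unipotent homomorphisms are polynomial. -/

section Unipotent

/-- The remaining terms of the exponential series start in degree two. -/
theorem exp_sub_one_sub_self_mem {B : Type*} [CommRing B] [Algebra ℚ B] {I : Ideal B} {a : B}
    (ha : a ∈ I) (hn : IsNilpotent a) : IsNilpotent.exp a - 1 - a ∈ I ^ 2 := by
  obtain ⟨k, hk⟩ := hn
  have hk' : a ^ (k + 2) = 0 := by rw [pow_add, hk, zero_mul]
  rw [IsNilpotent.exp_eq_sum hk', Finset.sum_range_succ', Finset.sum_range_succ']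
  have : ∑ i ∈ Finset.range k, ((i + 1 + 1).factorial : ℚ)⁻¹ • a ^ (i + 1 + 1) ∈ I ^ 2 := by
    refine Submodule.sum_mem _ fun i _ => ?_
    rw [Algebra.smul_def]
    exact Ideal.mul_mem_left _ _ (Ideal.pow_le_pow_right (by omega) (Ideal.pow_mem_pow ha _))
  simpa using this

variable {G B : Type*} [CommRing B] [Algebra ℂ B] [FiniteDimensional ℂ B]

theorem CoordinatesIn.exp [Algebra ℚ B] {S : Subalgebra ℂ (G → ℂ)} {F : G → B}
    (hF : CoordinatesIn S F) {L : ℕ} (hL : ∀ x, F x ^ L = 0) :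
    CoordinatesIn S (fun x => IsNilpotent.exp (F x)) := by
  simp only [fun x => IsNilpotent.exp_eq_sum (hL x)]
  refine CoordinatesIn.sum _ fun i => ?_
  have h : ∀ x, ((i.factorial : ℚ)⁻¹ • F x ^ i) = ((i.factorial : ℂ)⁻¹ • F x ^ i) := fun x => by
    have : IsScalarTower ℚ ℂ B := IsScalarTower.of_algebraMap_eq' (Subsingleton.elim _ _)
    rw [← algebraMap_smul ℂ ((i.factorial : ℚ)⁻¹)]
    simp
  simp only [h]
  exact (hF.pow i).smul _

variable [AddCommGroup G] [TopologicalSpace G]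

/-- If ν ≡ 1 modulo 𝔫^k, then ν − 1 is additive modulo 𝔫^(k+1), because products of two such
differences lie in 𝔫^(2k). Lift it to an additive map a; then ν·exp(−a) ≡ 1 modulo 𝔫^(k+1), and
exp(a) is polynomial in a. The number j bounds the steps left until 𝔫^L = 0. -/
theorem coordinatesIn_polyFun_of_sub_one_mem_pow {𝔫 : Ideal B} {L : ℕ} (h𝔫 : 𝔫 ^ L = ⊥) (j : ℕ) :
    ∀ k, 1 ≤ k → L ≤ k + j → ∀ ν : G → B, (∀ x y, ν (x + y) = ν x * ν y) →
      (∀ x, ν x - 1 ∈ 𝔫 ^ k) → CoordinatesIn (contFun G) ν → CoordinatesIn (polyFun G) ν := by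
  let _ : Algebra ℚ B := ((algebraMap ℂ B).comp (algebraMap ℚ ℂ)).toAlgebra
  induction j with
  | zero =>
    intro k _ hkL ν _ hν1 _
    have : ν = fun _ => 1 := by
      funext x
      have := Ideal.pow_le_pow_right (I := 𝔫) (by omega : L ≤ k) (hν1 x)
      rw [h𝔫, Ideal.mem_bot] at this
      exact sub_eq_zero.1 this
    rw [this]
    exact CoordinatesIn.const 1
  | succ j ih =>
    intro k hk hkL ν hν hν1 hνc
    -- A linear section of the quotient by 𝔫^(k+1): it makes the lift a exactly additive and keeps
    -- its coordinates continuous.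
    obtain ⟨s, hs⟩ := ((𝔫 ^ (k + 1)).restrictScalars ℂ).mkQ.exists_rightInverse_of_surjective
      (LinearMap.range_eq_top.2 (Submodule.mkQ_surjective _))
    let q := ((𝔫 ^ (k + 1)).restrictScalars ℂ).mkQ
    have hs' : ∀ z, q (s z) = z := fun z => LinearMap.congr_fun hs z
    let a : G →+ B := AddMonoidHom.mk' (fun x => s (q (ν x - 1))) fun x y => by
      rw [← map_add, ← map_add]
      congr 1
      refine (Submodule.Quotient.eq _).2 ?_
      have : ν (x + y) - 1 - (ν x - 1 + (ν y - 1)) = (ν x - 1) * (ν y - 1) := by rw [hν]; ring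
      rw [this]
      refine Ideal.pow_le_pow_right (by omega : k + 1 ≤ k + k) ?_
      rw [pow_add]
      exact Ideal.mul_mem_mul (hν1 x) (hν1 y)
    have ha1 : ∀ x, a x - (ν x - 1) ∈ 𝔫 ^ (k + 1) := fun x =>
      (Submodule.Quotient.eq ((𝔫 ^ (k + 1)).restrictScalars ℂ)).1 (hs' (q (ν x - 1)))
    have hak : ∀ x, a x ∈ 𝔫 ^ k := fun x => by
      have := Ideal.add_mem _ (Ideal.pow_le_pow_right k.le_succ (ha1 x)) (hν1 x)
      simpa using this
    have haL : ∀ x, a x ^ L = 0 := fun x => by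
      have := Ideal.pow_mem_pow (Ideal.pow_le_self (by omega) (hak x)) L
      rwa [h𝔫] at this
    have haL' : ∀ x, (-a x) ^ L = 0 := fun x => by rw [neg_pow, haL, mul_zero]
    have hap : CoordinatesIn (polyFun G) a := fun ℓ => by
      refine addMonoidHom_mem_polyFun (a := ℓ.toAddMonoidHom.comp a) ?_
      exact (hνc.sub (CoordinatesIn.const 1)) (ℓ ∘ₗ s ∘ₗ q)
    have hap' : CoordinatesIn (polyFun G) (fun x => -a x) := by
      simpa using hap.smul (-1)
    have hinv : ∀ x, IsNilpotent.exp (-a x) * IsNilpotent.exp (a x) = 1 := fun x =>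
      IsNilpotent.exp_neg_mul_exp_self ⟨L, haL x⟩
    have hν' := ih (k + 1) (by omega) (by omega) (fun x => ν x * IsNilpotent.exp (-a x))
      (fun x y => by
        rw [hν, map_add, neg_add, IsNilpotent.exp_add_of_commute (Commute.all _ _) ⟨L, haL' x⟩
          ⟨L, haL' y⟩]
        ring)
      (fun x => by
        have he : IsNilpotent.exp (-a x) - 1 - (-a x) ∈ 𝔫 ^ (k + 1) :=
          Ideal.pow_le_pow_right (by omega : k + 1 ≤ k * 2) (pow_mul 𝔫 k 2 ▸
            exp_sub_one_sub_self_mem (neg_mem (hak x)) ⟨L, haL' x⟩)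
        have hm : (ν x - 1) * a x ∈ 𝔫 ^ (k + 1) :=
          Ideal.pow_le_pow_right (by omega : k + 1 ≤ k + k) (pow_add 𝔫 k k ▸
            Ideal.mul_mem_mul (hν1 x) (hak x))
        -- All three terms lie in 𝔫^(k+1); for the first two this uses 2k ≥ k+1.
        have : ν x * IsNilpotent.exp (-a x) - 1 = ν x * (IsNilpotent.exp (-a x) - 1 - (-a x)) -
            (ν x - 1) * a x - (a x - (ν x - 1)) := by ring
        rw [this]
        exact sub_mem (sub_mem (Ideal.mul_mem_left _ _ he) hm) (ha1 x))
      (hνc.mul fun ℓ => polyFun_le_contFun (hap'.exp haL' ℓ))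
    have : ν = fun x => ν x * IsNilpotent.exp (-a x) * IsNilpotent.exp (a x) := by
      funext x
      rw [mul_assoc, hinv, mul_one]
    rw [this]
    exact hν'.mul (hap.exp haL)

/-- A weakly continuous unipotent representation in a finite dimensional commutative algebra has
polynomial coordinates. -/
theorem coordinatesIn_polyFun_of_sub_one_mem {𝔫 : Ideal B} {L : ℕ} (h𝔫 : 𝔫 ^ L = ⊥) {ν : G → B}
    (hν : ∀ x y, ν (x + y) = ν x * ν y) (hν1 : ∀ x, ν x - 1 ∈ 𝔫)
    (hνc : CoordinatesIn (contFun G) ν) : CoordinatesIn (polyFun G) ν :=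
  coordinatesIn_polyFun_of_sub_one_mem_pow h𝔫 L 1 le_rfl (by omega) ν hν (by simpa using hν1) hνc

end Unipotent

/-! ### Characters and local parts of a finite dimensional commutative algebra. -/

section Characters

variable {Q : Type*} [CommRing Q] [Algebra ℂ Q] [FiniteDimensional ℂ Q]

/-- The residue field is a finite extension of ℂ, hence ℂ itself. -/
theorem exists_character_of_isMaximal (M : Ideal Q) [hM : M.IsMaximal] :
    ∃ χ : Q →ₐ[ℂ] ℂ, RingHom.ker χ = M := by
  let _ : Field (Q ⧸ M) := Ideal.Quotient.field M
  have hb : Function.Bijective (algebraMap ℂ (Q ⧸ M)) :=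
    IsAlgClosed.algebraMap_bijective_of_isIntegral
  let e : ℂ ≃ₐ[ℂ] Q ⧸ M := AlgEquiv.ofBijective (Algebra.ofId ℂ (Q ⧸ M)) hb
  refine ⟨(e.symm : Q ⧸ M →ₐ[ℂ] ℂ).comp (Ideal.Quotient.mkₐ ℂ M), ?_⟩
  ext x
  simp [RingHom.mem_ker, Ideal.Quotient.eq_zero_iff_mem]

theorem exists_character_of_ne_top {I : Ideal Q} (hI : I ≠ ⊤) :
    ∃ χ : Q →ₐ[ℂ] ℂ, I ≤ RingHom.ker χ := by
  obtain ⟨M, hM, hIM⟩ := Ideal.exists_le_maximal I hI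
  obtain ⟨χ, rfl⟩ := exists_character_of_isMaximal M
  exact ⟨χ, hIM⟩

/-- A nonzero element `q` survives at some character, which kills the annihilator of `q`. -/
theorem exists_character_of_mul_ne_zero {q : Q} (hq : q ≠ 0) :
    ∃ χ : Q →ₐ[ℂ] ℂ, ∀ z, q * z = 0 → χ z = 0 := by
  obtain ⟨χ, hχ⟩ := exists_character_of_ne_top (I := (Ideal.span {q}).annihilator)
    (fun h => hq (by
      have : (1 : Q) ∈ (Ideal.span {q}).annihilator := h ▸ Submodule.mem_top
      simpa using (Submodule.mem_annihilator_span_singleton q 1).1 this))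
  refine ⟨χ, fun z hz => hχ ((Submodule.mem_annihilator_span_singleton q z).2 ?_)⟩
  rw [smul_eq_mul, mul_comm, hz]

omit [FiniteDimensional ℂ Q] in
-- The element q − χ(q)·1 lies in the kernel of χ, so the kernel determines the value χ(q).
theorem ker_character_injective :
    Function.Injective (fun χ : Q →ₐ[ℂ] ℂ => RingHom.ker χ) := by
  intro χ χ' h
  ext q
  have : q - algebraMap ℂ Q (χ q) ∈ RingHom.ker χ' := by
    change RingHom.ker χ = RingHom.ker χ' at h
    rw [← h]
    simp [RingHom.mem_ker]
  have h' : χ' q - χ q = 0 := by simpa [RingHom.mem_ker] using this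
  exact (sub_eq_zero.1 h').symm

omit [FiniteDimensional ℂ Q] in
theorem isMaximal_ker_character (χ : Q →ₐ[ℂ] ℂ) : (RingHom.ker χ).IsMaximal :=
  RingHom.ker_isMaximal_of_surjective χ fun z => ⟨algebraMap ℂ Q z, by simp⟩

omit [FiniteDimensional ℂ Q] in
theorem isCoprime_ker_pow {χ χ' : Q →ₐ[ℂ] ℂ} (h : χ ≠ χ') (m n : ℕ) :
    RingHom.ker χ ^ m ⊔ RingHom.ker χ' ^ n = ⊤ := by
  have := isMaximal_ker_character χ
  have := isMaximal_ker_character χ'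
  refine Ideal.isCoprime_iff_sup_eq.1 (IsCoprime.pow (Ideal.isCoprime_iff_sup_eq.2 ?_))
  exact Ideal.IsMaximal.coprime_of_ne ‹_› ‹_› fun h' => h (ker_character_injective h')

/-- In an Artinian ring every prime is maximal, hence here the kernel of a character. The product of
all kernels therefore lies in the nilradical, which is nilpotent. -/
theorem exists_prod_ker_pow_eq_bot [Fintype (Q →ₐ[ℂ] ℂ)] :
    ∃ L : ℕ, ∏ χ : Q →ₐ[ℂ] ℂ, RingHom.ker χ ^ L = ⊥ := by
  have : IsArtinianRing Q := IsArtinianRing.of_finite ℂ Q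
  obtain ⟨L, hL⟩ := IsArtinianRing.isNilpotent_nilradical (R := Q)
  refine ⟨L, ?_⟩
  rw [Finset.prod_pow, eq_bot_iff, ← Ideal.zero_eq_bot, ← hL]
  refine Ideal.pow_right_mono ?_ L
  rw [nilradical_eq_sInf]
  refine le_sInf fun P hP => ?_
  have hP : P.IsPrime := hP
  have : P.IsMaximal := IsArtinianRing.isMaximal_of_isPrime P
  obtain ⟨χ, rfl⟩ := exists_character_of_isMaximal P
  exact Ideal.prod_le_inf.trans (Finset.inf_le (Finset.mem_univ χ))

/-- Approximate idempotents splitting a finite dimensional algebra into its local parts. -/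
theorem exists_local_partition [Fintype (Q →ₐ[ℂ] ℂ)] [Nontrivial Q] :
    ∃ (L : ℕ) (ε : (Q →ₐ[ℂ] ℂ) → Q), ∑ χ, ε χ = 1 ∧
      ∀ χ, ∀ z ∈ RingHom.ker χ ^ L, ε χ * z = 0 := by
  obtain ⟨L, hL⟩ := exists_prod_ker_pow_eq_bot (Q := Q)
  obtain ⟨χ₀, -⟩ := exists_character_of_ne_top (bot_ne_top (α := Ideal Q))
  -- Comaximality gives a partition of unity with ε χ in ker χ'^L for every χ' ≠ χ.
  have h := (Ideal.iSup_iInf_eq_top_iff_pairwise (t := Finset.univ) ⟨χ₀, Finset.mem_univ _⟩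
    (fun χ : Q →ₐ[ℂ] ℂ => RingHom.ker χ ^ L)).2
    (fun χ _ χ' _ hne => isCoprime_ker_pow hne L L)
  rw [Ideal.eq_top_iff_one, Submodule.mem_iSup_finset_iff_exists_sum] at h
  obtain ⟨ε, hε⟩ := h
  refine ⟨L, fun χ => ε χ, hε, fun χ z hz => ?_⟩
  have h1 : (ε χ : Q) * z ∈ ⨅ χ' ∈ (Finset.univ : Finset (Q →ₐ[ℂ] ℂ)), RingHom.ker χ' ^ L := by
    simp only [Submodule.mem_iInf, Finset.mem_univ, true_imp_iff]
    intro χ'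
    by_cases hc : χ' = χ
    · subst hc
      exact Ideal.mul_mem_left _ _ hz
    · have := (ε χ).2
      simp only [Submodule.mem_iInf, Finset.mem_univ, true_imp_iff] at this
      exact Ideal.mul_mem_right _ _ (this χ' hc)
  -- For pairwise comaximal ideals the intersection equals the product, which is zero.
  rw [← Ideal.prod_eq_iInf_of_pairwise_isCoprime fun χ _ χ' _ hne =>
    Ideal.isCoprime_iff_sup_eq.2 (isCoprime_ker_pow hne L L), hL] at h1
  exact h1

end Characters

/-! ### Matrix coefficients as exponential polynomials. -/

section Decomposition

variable {G Q : Type*} [AddCommGroup G] [TopologicalSpace G] [CommRing Q] [Algebra ℂ Q]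

theorem isExponential_character {π : G → Q} (h0 : π 0 = 1) (hadd : ∀ x y, π (x + y) = π x * π y)
    (hc : CoordinatesIn (contFun G) π) (χ : Q →ₐ[ℂ] ℂ) : IsExponential (fun x => χ (π x)) := by
  refine ⟨hc χ.toLinearMap, fun x hx => ?_, fun x y => by simp only [hadd, map_mul]⟩
  have : χ (π (x + -x)) = 1 := by rw [add_neg_cancel, h0, map_one]
  rw [hadd, map_mul, show χ (π x) = 0 from hx, zero_mul] at this
  exact zero_ne_one this

/-- The matrix coefficients of a weakly continuous representation in a finite dimensional
commutative algebra are exponential polynomials. -/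
theorem exists_exponential_decomposition [FiniteDimensional ℂ Q] [Fintype (Q →ₐ[ℂ] ℂ)]
    [Nontrivial Q] {π : G → Q} (h0 : π 0 = 1) (hadd : ∀ x y, π (x + y) = π x * π y)
    (hc : CoordinatesIn (contFun G) π) (ℓ : Q →ₗ[ℂ] ℂ) :
    ∃ p : (Q →ₐ[ℂ] ℂ) → G → ℂ, (∀ χ, p χ ∈ polyFun G) ∧
      ∀ x, ℓ (π x) = ∑ χ, p χ x * χ (π x) := by
  obtain ⟨L, ε, hε, hεL⟩ := exists_local_partition (Q := Q)
  have key : ∀ χ : Q →ₐ[ℂ] ℂ, ∃ p ∈ polyFun G, ∀ x, ℓ (ε χ * π x) = p x * χ (π x) := by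
    intro χ
    obtain ⟨hχc, hχ0, hχadd⟩ := isExponential_character h0 hadd hc χ
    let q := Ideal.Quotient.mkₐ ℂ (RingHom.ker χ ^ L)
    -- Since ε χ kills ker χ^L, the functional z ↦ ℓ(ε χ · z) factors through the local quotient.
    let ℓ' : (Q ⧸ RingHom.ker χ ^ L) →ₗ[ℂ] ℂ :=
      ((RingHom.ker χ ^ L).restrictScalars ℂ).liftQ (ℓ ∘ₗ LinearMap.mulLeft ℂ (ε χ))
        (fun z hz => by
          have := hεL χ z hz
          simp [LinearMap.mem_ker, this])
    have hℓ' : ∀ z, ℓ' (q z) = ℓ (ε χ * z) := fun z => rfl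
    -- Division by the exponential χ∘π makes the representation unipotent on the local quotient.
    have hν := coordinatesIn_polyFun_of_sub_one_mem (𝔫 := (RingHom.ker χ).map q) (L := L)
      (ν := fun x => (χ (π x))⁻¹ • q (π x))
      (by rw [← Ideal.map_pow]; exact Ideal.map_quotient_self _)
      (fun x y => by
        rw [show χ (π (x + y)) = χ (π x) * χ (π y) from hχadd x y, hadd, map_mul,
          smul_mul_smul_comm, mul_inv])
      (fun x => by
        have : (χ (π x))⁻¹ • q (π x) - 1 = q ((χ (π x))⁻¹ • π x - 1) := by simp
        rw [this]
        refine Ideal.mem_map_of_mem _ ?_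
        simp [RingHom.mem_ker, hχ0 x])
      (fun m => by
        simp only [map_smul]
        exact (hχc.inv₀ hχ0).mul (hc (m ∘ₗ q.toLinearMap)))
    refine ⟨_, hν ℓ', fun x => ?_⟩
    rw [map_smul, hℓ', smul_eq_mul]
    field_simp [hχ0 x]
  choose p hp hpx using key
  refine ⟨p, hp, fun x => ?_⟩
  rw [← Finset.sum_congr rfl fun χ _ => hpx χ x, ← map_sum, ← Finset.sum_mul, hε, one_mul]

end Decomposition

/-! ### The orbit algebra of a vector and its finiteness over the nodes. -/

section Orbit

variable {G E : Type*} [AddCommGroup G] [AddCommGroup E] [Module ℂ E]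

/-- The action of the group algebra that extends a representation of the group `G`. -/
noncomputable def groupAlgebraRep (T : Multiplicative G →* Module.End ℂ E) :
    AddMonoidAlgebra ℂ G →ₐ[ℂ] Module.End ℂ E :=
  AddMonoidAlgebra.lift ℂ _ G T

theorem groupAlgebraRep_mul_apply (T : Multiplicative G →* Module.End ℂ E)
    (a b : AddMonoidAlgebra ℂ G) (e : E) :
    groupAlgebraRep T (a * b) e = groupAlgebraRep T a (groupAlgebraRep T b e) := by
  rw [map_mul, Module.End.mul_apply]

/-- The ideal of the group algebra that annihilates a vector. -/
noncomputable def annihilatorOf (T : Multiplicative G →* Module.End ℂ E) (e : E) :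
    Ideal (AddMonoidAlgebra ℂ G) where
  carrier := {a | groupAlgebraRep T a e = 0}
  add_mem' := fun {a b} ha hb => by
    simp only [Set.mem_ofPred_eq, map_add, LinearMap.add_apply] at *
    rw [ha, hb, add_zero]
  zero_mem' := by simp
  smul_mem' := fun c a ha => by
    simp only [Set.mem_ofPred_eq, smul_eq_mul, map_mul, Module.End.mul_apply] at *
    rw [ha, map_zero]

/-- The algebra through which the group algebra acts on the cyclic module generated by a vector. -/
abbrev OrbitAlgebra (T : Multiplicative G →* Module.End ℂ E) (e : E) : Type _ :=
  AddMonoidAlgebra ℂ G ⧸ annihilatorOf T e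

namespace OrbitAlgebra

variable (T : Multiplicative G →* Module.End ℂ E) (e : E)

/-- The class of a group element. -/
noncomputable def point (x : G) : OrbitAlgebra T e :=
  Ideal.Quotient.mk _ (AddMonoidAlgebra.single x 1)

/-- The isomorphism of the orbit algebra with the cyclic module, as a map into the module. -/
noncomputable def orbitMap : OrbitAlgebra T e →ₗ[ℂ] E :=
  ((annihilatorOf T e).restrictScalars ℂ).liftQ
    ((LinearMap.applyₗ e).comp (groupAlgebraRep T).toLinearMap) (fun _ ha => ha)

theorem orbitMap_mk (a : AddMonoidAlgebra ℂ G) :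
    orbitMap T e (Ideal.Quotient.mk _ a) = groupAlgebraRep T a e := rfl

theorem groupAlgebraRep_single (x : G) :
    groupAlgebraRep T (AddMonoidAlgebra.single x 1) = T (Multiplicative.ofAdd x) := by
  simp [groupAlgebraRep]

theorem orbitMap_point (x : G) : orbitMap T e (point T e x) = T (Multiplicative.ofAdd x) e := by
  rw [point, orbitMap_mk, groupAlgebraRep_single]

theorem orbitMap_injective : Function.Injective (orbitMap T e) := by
  refine (injective_iff_map_eq_zero _).2 fun q hq => ?_
  obtain ⟨a, rfl⟩ := Ideal.Quotient.mk_surjective q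
  exact Ideal.Quotient.eq_zero_iff_mem.2 hq

theorem point_zero : point T e 0 = 1 := rfl

theorem point_add (x y : G) : point T e (x + y) = point T e x * point T e y := by
  simp [point, ← map_mul, AddMonoidAlgebra.single_mul_single]

theorem span_range_point : Submodule.span ℂ (Set.range (point T e)) = ⊤ := by
  rw [eq_top_iff]
  rintro q -
  obtain ⟨a, rfl⟩ := Ideal.Quotient.mk_surjective q
  induction a using AddMonoidAlgebra.induction_on with
  | of x => exact Submodule.subset_span ⟨x, rfl⟩
  | add a b ha hb => rw [map_add]; exact Submodule.add_mem _ ha hb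
  | smul c a ha =>
    have : Ideal.Quotient.mk (annihilatorOf T e) (c • a) = c • Ideal.Quotient.mk _ a := rfl
    rw [this]
    exact Submodule.smul_mem _ _ ha

theorem nontrivial {e : E} (he : e ≠ 0) : Nontrivial (OrbitAlgebra T e) := by
  refine ⟨⟨1, 0, fun h => he ?_⟩⟩
  have := congrArg (orbitMap T e) h
  rwa [← point_zero, orbitMap_point, ofAdd_zero, map_one, map_zero] at this

/-- The element of the orbit algebra that acts as `mixedDiff`. -/
noncomputable def mixed {r : ℕ} (φ : Fin r → G → ℂ) (n : Fin r → ℕ) (y : Fin r → G)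
    (l : List (Fin r)) : OrbitAlgebra T e :=
  (l.map fun k => (point T e (y k) - algebraMap ℂ _ (φ k (y k))) ^ (n k + 1)).prod

theorem orbitMap_mixed {r : ℕ} (φ : Fin r → G → ℂ) (n : Fin r → ℕ) (y : Fin r → G)
    (l : List (Fin r)) :
    orbitMap T e (mixed T e φ n y l) =
      mixedDiff (fun x => T (Multiplicative.ofAdd x)) φ n y l e := by
  have h1 : mixed T e φ n y l = Ideal.Quotient.mk _ ((l.map fun k =>
      (AddMonoidAlgebra.single (y k) 1 - algebraMap ℂ (AddMonoidAlgebra ℂ G) (φ k (y k))) ^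
        (n k + 1)).prod) := by
    rw [mixed, map_list_prod, List.map_map]
    rfl
  have h2 : groupAlgebraRep T ((l.map fun k =>
      (AddMonoidAlgebra.single (y k) 1 - algebraMap ℂ (AddMonoidAlgebra ℂ G) (φ k (y k))) ^
        (n k + 1)).prod) = mixedDiff (fun x => T (Multiplicative.ofAdd x)) φ n y l := by
    rw [mixedDiff, map_list_prod, List.map_map]
    congr 2
    funext k
    simp only [Function.comp, map_pow, map_sub, groupAlgebraRep_single, AlgHom.commutes, modDiff]
    rfl
  rw [h1, orbitMap_mk, h2]

theorem mixed_eq_zero_iff {r : ℕ} {φ : Fin r → G → ℂ} {n : Fin r → ℕ} {y : Fin r → G}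
    {l : List (Fin r)} : mixed T e φ n y l = 0 ↔
      mixedDiff (fun x => T (Multiplicative.ofAdd x)) φ n y l e = 0 := by
  rw [← orbitMap_mixed, map_eq_zero_iff _ (orbitMap_injective T e)]

theorem isIntegral_point_neg {x : G} (hx : IsIntegral ℂ (point T e x)) :
    IsIntegral ℂ (point T e (-x)) := by
  let _ : Invertible (point T e x) :=
    ⟨point T e (-x), by rw [← point_add, neg_add_cancel, point_zero],
      by rw [← point_add, add_neg_cancel, point_zero]⟩
  exact hx.isAlgebraic.invOf.isIntegral

/-- The mixed equation makes the cyclic module over the subgroup generated by the nodes finite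
dimensional. -/
theorem finiteDimensional_span_of_nodeDiff {r t : ℕ} {g : Fin t → G} {n : Fin r → Fin t → ℕ}
    {φ : Fin r → G → ℂ}
    (h : ∀ i, nodeDiff (fun x => T (Multiplicative.ofAdd x)) g n φ i e = 0) :
    ∃ V : Submodule ℂ E, FiniteDimensional ℂ V ∧
      ∀ x ∈ AddSubgroup.closure (Set.range g), T (Multiplicative.ofAdd x) e ∈ V := by
  -- Only the equations with all indices equal are needed: they exhibit a monic polynomial that
  -- annihilates the class of g i.
  have hint : ∀ i, IsIntegral ℂ (point T e (g i)) := fun i => by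
    refine ⟨∏ k, (Polynomial.X - Polynomial.C (φ k (g i))) ^ (n k i + 1),
      Polynomial.monic_prod_of_monic _ _ fun k _ => (Polynomial.monic_X_sub_C _).pow _, ?_⟩
    have := (mixed_eq_zero_iff T e).2 (h fun _ => i)
    rw [mixed, ← Fin.prod_univ_def] at this
    rw [← Polynomial.aeval_def, map_prod, ← this]
    simp
  let s : Set (OrbitAlgebra T e) :=
    Set.range (fun i => point T e (g i)) ∪ Set.range (fun i => point T e (-g i))
  have hfg := fg_adjoin_of_finite (R := ℂ) (s := s) ((Set.finite_range _).union (Set.finite_range _))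
    (by
      rintro _ (⟨i, rfl⟩ | ⟨i, rfl⟩)
      · exact hint i
      · exact isIntegral_point_neg T e (hint i))
  refine ⟨(Subalgebra.toSubmodule (Algebra.adjoin ℂ s)).map (orbitMap T e),
    Module.Finite.iff_fg.2 (hfg.map _), fun x hx => ?_⟩
  refine ⟨point T e x, ?_, orbitMap_point T e x⟩
  -- Both signs are carried through the induction, so that the step to negatives is a swap.
  have : point T e x ∈ Algebra.adjoin ℂ s ∧ point T e (-x) ∈ Algebra.adjoin ℂ s := by
    induction hx using AddSubgroup.closure_induction with
    | mem x hx =>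
      obtain ⟨i, rfl⟩ := hx
      exact ⟨Algebra.subset_adjoin (Or.inl ⟨i, rfl⟩), Algebra.subset_adjoin (Or.inr ⟨i, rfl⟩)⟩
    | zero => simp [point_zero, one_mem]
    | add x y _ _ hx hy =>
      rw [neg_add, point_add, point_add]
      exact ⟨mul_mem hx.1 hy.1, mul_mem hx.2 hy.2⟩
    | neg x _ hx => rw [neg_neg]; exact hx.symm
  exact this.1

end OrbitAlgebra

end Orbit

/-! ### Weak closedness of finite dimensional subspaces. -/

section Density

variable {G E : Type*} [AddCommGroup E] [Module ℂ E]

/-- Functionals that separate points restrict to all functionals on finite dimensional subspaces. -/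
theorem exists_mem_span_eq_on {Λ : Set (E →ₗ[ℂ] ℂ)} (hΛ : ∀ e, (∀ ℓ ∈ Λ, ℓ e = 0) → e = 0)
    {M : Type*} [AddCommGroup M] [Module ℂ M] [FiniteDimensional ℂ M] {j : M →ₗ[ℂ] E}
    (hj : Function.Injective j) (m : M →ₗ[ℂ] ℂ) :
    ∃ ℓ ∈ Submodule.span ℂ Λ, ℓ ∘ₗ j = m := by
  have h := Submodule.span_eq_top_of_ne_zero (R := ℂ) (M := M) (s := (fun ℓ : E →ₗ[ℂ] ℂ => ℓ ∘ₗ j) '' Λ)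
    (fun z hz => by
      by_contra! hc
      exact hz (hj (by rw [map_zero]; exact hΛ _ fun ℓ hℓ => hc _ ⟨ℓ, hℓ, rfl⟩)))
  have hm : m ∈ Submodule.span ℂ ((fun ℓ : E →ₗ[ℂ] ℂ => ℓ ∘ₗ j) '' Λ) := h ▸ Submodule.mem_top
  have : ((fun ℓ : E →ₗ[ℂ] ℂ => ℓ ∘ₗ j) '' Λ) = (LinearMap.lcomp ℂ ℂ j) '' Λ := rfl
  rw [this, Submodule.span_image] at hm
  exact hm

variable [TopologicalSpace G]

theorem continuous_of_mem_span {Λ : Set (E →ₗ[ℂ] ℂ)} {F : G → E}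
    (hF : ∀ ℓ ∈ Λ, Continuous fun x => ℓ (F x)) {ℓ : E →ₗ[ℂ] ℂ} (hℓ : ℓ ∈ Submodule.span ℂ Λ) :
    Continuous fun x => ℓ (F x) := by
  induction hℓ using Submodule.span_induction with
  | mem ℓ h => exact hF ℓ h
  | zero => exact continuous_const
  | add ℓ m _ _ h h' => exact h.add h'
  | smul c ℓ _ h => exact h.const_smul c

/-- Finite dimensional subspaces are closed for the weak topology of a separating set. -/
theorem mem_of_dense_of_finiteDimensional {Λ : Set (E →ₗ[ℂ] ℂ)}
    (hΛ : ∀ e, (∀ ℓ ∈ Λ, ℓ e = 0) → e = 0) {F : G → E}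
    (hF : ∀ ℓ ∈ Λ, Continuous fun x => ℓ (F x)) {D : Set G} (hD : Dense D) (V : Submodule ℂ E)
    [FiniteDimensional ℂ V] (hV : ∀ x ∈ D, F x ∈ V) (x : G) : F x ∈ V := by
  by_contra hx
  -- A functional on W that vanishes on V but not identically is the restriction of a combination of
  -- elements of Λ. The latter is continuous along F and zero on D, hence zero at x.
  let W : Submodule ℂ E := V ⊔ Submodule.span ℂ {F x}
  let V' : Submodule ℂ W := V.comap W.subtype
  obtain ⟨m, hm, hmV⟩ := Submodule.exists_dual_map_eq_bot_of_notMem (p := V')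
    (x := ⟨F x, Submodule.mem_sup_right (Submodule.mem_span_singleton_self _)⟩) hx inferInstance
  obtain ⟨ℓ, hℓ, hℓm⟩ := exists_mem_span_eq_on hΛ (j := W.subtype) Subtype.val_injective m
  have h0 : (fun x => ℓ (F x)) = fun _ => 0 :=
    Continuous.ext_on hD (continuous_of_mem_span hF hℓ) continuous_const fun y hy => by
      have hy' : (⟨F y, Submodule.mem_sup_left (hV y hy)⟩ : W) ∈ V' := hV y hy
      have h1 : m ⟨F y, Submodule.mem_sup_left (hV y hy)⟩ = 0 := by
        have := Submodule.mem_map_of_mem (f := m) hy'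
        rwa [hmV, Submodule.mem_bot] at this
      rw [← hℓm] at h1
      exact h1
  apply hm
  rw [← hℓm]
  exact congrFun h0 x

end Density

/-! ### Finiteness and weak continuity of the orbit algebra over the whole group. -/

section Orbit

variable {G E : Type*} [AddCommGroup G] [TopologicalSpace G] [AddCommGroup E] [Module ℂ E]

namespace OrbitAlgebra

/-- A weakly continuous vector satisfying the mixed equation at topological generators of the group
generates a finite dimensional invariant subspace. -/
theorem finiteDimensional_of_nodeDiff (T : Multiplicative G →* Module.End ℂ E) {e : E}
    {Λ : Set (E →ₗ[ℂ] ℂ)} (hΛ : ∀ e, (∀ ℓ ∈ Λ, ℓ e = 0) → e = 0)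
    (he : ∀ ℓ ∈ Λ, Continuous fun x => ℓ (T (Multiplicative.ofAdd x) e))
    {r t : ℕ} {g : Fin t → G} {n : Fin r → Fin t → ℕ} {φ : Fin r → G → ℂ}
    (hg : Dense (AddSubgroup.closure (Set.range g) : Set G))
    (h : ∀ i, nodeDiff (fun x => T (Multiplicative.ofAdd x)) g n φ i e = 0) :
    FiniteDimensional ℂ (OrbitAlgebra T e) := by
  obtain ⟨V, hV, hVe⟩ := finiteDimensional_span_of_nodeDiff T e h
  have hmem := mem_of_dense_of_finiteDimensional hΛ he hg V hVe
  have hV' : ∀ q, orbitMap T e q ∈ V := by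
    have : (⊤ : Submodule ℂ (OrbitAlgebra T e)) ≤ V.comap (orbitMap T e) := by
      rw [← span_range_point, Submodule.span_le]
      rintro _ ⟨x, rfl⟩
      change orbitMap T e (point T e x) ∈ V
      rw [orbitMap_point]
      exact hmem x
    exact fun q => this Submodule.mem_top
  exact FiniteDimensional.of_injective ((orbitMap T e).codRestrict V hV')
    fun a b hab => orbitMap_injective T e (congrArg Subtype.val hab)

theorem coordinatesIn_contFun_point (T : Multiplicative G →* Module.End ℂ E) {e : E}
    [FiniteDimensional ℂ (OrbitAlgebra T e)]
    {Λ : Set (E →ₗ[ℂ] ℂ)} (hΛ : ∀ e, (∀ ℓ ∈ Λ, ℓ e = 0) → e = 0)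
    (he : ∀ ℓ ∈ Λ, Continuous fun x => ℓ (T (Multiplicative.ofAdd x) e)) :
    CoordinatesIn (contFun G) (point T e) := fun m => by
  obtain ⟨ℓ, hℓ, rfl⟩ := exists_mem_span_eq_on hΛ (orbitMap_injective T e) m
  simp only [LinearMap.comp_apply, orbitMap_point]
  exact continuous_of_mem_span he hℓ

end OrbitAlgebra

end Orbit

/-! ### Polynomial degree, and reduced forms as sources of characters. -/

section FunctionTranslations

variable {G : Type*} [AddCommGroup G]

/-- Translations of functions as a representation. -/
def translateFunHom (G : Type*) [AddCommGroup G] : Multiplicative G →* Module.End ℂ (G → ℂ) where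
  toFun y := translateFun y.toAdd
  map_one' := by
    ext f x
    simp [translateFun]
  map_mul' y z := by
    ext f x
    simp [translateFun, add_assoc]

theorem translateFunHom_ofAdd (y : G) :
    translateFunHom G (Multiplicative.ofAdd y) = translateFun y := rfl

/-- The functions annihilated by all products of `n` difference operators. -/
def differenceDegree (G : Type*) [AddCommGroup G] : ℕ → Submodule ℂ (G → ℂ)
  | 0 => ⊥
  | n + 1 => ⨅ x : G, (differenceDegree G n).comap (translateFun x - 1)

theorem mem_differenceDegree_succ {n : ℕ} {p : G → ℂ} :
    p ∈ differenceDegree G (n + 1) ↔ ∀ x, translateFun x p - p ∈ differenceDegree G n := by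
  simp [differenceDegree, Submodule.mem_iInf]

theorem differenceDegree_le_succ (n : ℕ) : differenceDegree G n ≤ differenceDegree G (n + 1) := by
  induction n with
  | zero => exact bot_le
  | succ n ih =>
    intro p hp
    rw [mem_differenceDegree_succ] at hp ⊢
    exact fun x => ih (hp x)

theorem differenceDegree_mono : Monotone (differenceDegree G) :=
  monotone_nat_of_le_succ differenceDegree_le_succ

theorem translateFun_mem_differenceDegree {n : ℕ} {p : G → ℂ} (hp : p ∈ differenceDegree G n)
    (y : G) : translateFun y p ∈ differenceDegree G n := by
  induction n generalizing p with
  | zero =>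
    have : p = 0 := hp
    rw [this, map_zero]
    exact zero_mem _
  | succ n ih =>
    rw [mem_differenceDegree_succ] at hp ⊢
    intro x
    have : translateFun x (translateFun y p) - translateFun y p =
        translateFun y (translateFun x p - p) := by
      ext z
      simp [translateFun, add_right_comm]
    rw [this]
    exact ih (hp x)

/-- Induction through the Leibniz rule for differences. The index is one more than the degree, so n
+ m is not sharp, but any finite bound serves. -/
theorem mul_mem_differenceDegree (N : ℕ) : ∀ n m, n + m = N → ∀ p q : G → ℂ,
    p ∈ differenceDegree G n → q ∈ differenceDegree G m → p * q ∈ differenceDegree G N := by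
  induction N with
  | zero =>
    intro n m hnm p q hp _
    obtain rfl : n = 0 := by omega
    rw [show p = 0 from hp, zero_mul]
    exact zero_mem _
  | succ N ih =>
    intro n m hnm p q hp hq
    rcases n with _ | n
    · rw [show p = 0 from hp, zero_mul]
      exact zero_mem _
    rcases m with _ | m
    · rw [show q = 0 from hq, mul_zero]
      exact zero_mem _
    rw [mem_differenceDegree_succ]
    intro x
    have : translateFun x (p * q) - p * q =
        (translateFun x p - p) * translateFun x q + p * (translateFun x q - q) := by
      ext z
      simp only [translateFun, LinearMap.coe_mk, AddHom.coe_mk, Pi.sub_apply, Pi.mul_apply,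
        Pi.add_apply]
      ring
    rw [this]
    exact add_mem
      (ih n (m + 1) (by omega) _ _ (mem_differenceDegree_succ.1 hp x)
        (translateFun_mem_differenceDegree hq x))
      (ih (n + 1) m (by omega) _ _ hp (mem_differenceDegree_succ.1 hq x))

theorem const_mem_differenceDegree (c : ℂ) : (fun _ : G => c) ∈ differenceDegree G 1 := by
  rw [mem_differenceDegree_succ]
  intro x
  have : translateFun x (fun _ : G => c) - (fun _ => c) = 0 := by
    ext z
    simp [translateFun]
  rw [this]
  exact zero_mem _

theorem exists_mem_differenceDegree [TopologicalSpace G] {p : G → ℂ} (hp : p ∈ polyFun G) :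
    ∃ n, p ∈ differenceDegree G n := by
  induction hp using Algebra.adjoin_induction with
  | mem p hp =>
    obtain ⟨α, -, rfl⟩ := hp
    refine ⟨2, mem_differenceDegree_succ.2 fun x => ?_⟩
    have : translateFun x (α : G → ℂ) - (α : G → ℂ) = fun _ => α x := by
      ext z
      simp [translateFun]
    rw [this]
    exact const_mem_differenceDegree (α x)
  | algebraMap c => exact ⟨1, const_mem_differenceDegree c⟩
  | add p q _ _ hp hq =>
    obtain ⟨n, hn⟩ := hp
    obtain ⟨m, hm⟩ := hq
    exact ⟨max n m, add_mem (differenceDegree_mono (le_max_left _ _) hn)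
      (differenceDegree_mono (le_max_right _ _) hm)⟩
  | mul p q _ _ hp hq =>
    obtain ⟨n, hn⟩ := hp
    obtain ⟨m, hm⟩ := hq
    exact ⟨n + m, mul_mem_differenceDegree _ n m rfl p q hn hm⟩

variable [TopologicalSpace G]

theorem IsExponential.map_zero {e : G → ℂ} (he : IsExponential e) : e 0 = 1 := by
  have := he.2.2 0 0
  rw [add_zero] at this
  exact (mul_eq_left₀ (he.2.1 0)).1 this.symm

/-- The character of the group algebra given by an exponential. -/
noncomputable def IsExponential.character {e : G → ℂ} (he : IsExponential e) :
    AddMonoidAlgebra ℂ G →ₐ[ℂ] ℂ :=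
  AddMonoidAlgebra.lift ℂ ℂ G
    { toFun := fun x => e x.toAdd
      map_one' := he.map_zero
      map_mul' := fun x y => he.2.2 x.toAdd y.toAdd }

theorem IsExponential.character_single {e : G → ℂ} (he : IsExponential e) (x : G) :
    he.character (AddMonoidAlgebra.single x 1) = e x := by
  simp [IsExponential.character]

/-- Translation by x turns p·e into e(x)·(τ_x p)·e. Up to terms of lower degree, an element of the
group algebra therefore acts on p·e by the scalar that the character of e assigns to it. -/
theorem groupAlgebraRep_sub_character_mem {e : G → ℂ} (he : IsExponential e) {n : ℕ} {p : G → ℂ}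
    (hp : p ∈ differenceDegree G (n + 1)) (a : AddMonoidAlgebra ℂ G) :
    groupAlgebraRep (translateFunHom G) a (p * e) - he.character a • (p * e) ∈
      (differenceDegree G n).map (LinearMap.mulRight ℂ e) := by
  induction a using AddMonoidAlgebra.induction_on with
  | of x =>
    refine ⟨e x • (translateFun x p - p),
      Submodule.smul_mem _ _ (mem_differenceDegree_succ.1 hp x), ?_⟩
    change _ = groupAlgebraRep (translateFunHom G) (AddMonoidAlgebra.single x 1) (p * e) -
      he.character (AddMonoidAlgebra.single x 1) • (p * e)
    rw [OrbitAlgebra.groupAlgebraRep_single, he.character_single, translateFunHom_ofAdd]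
    ext z
    simp only [translateFun, LinearMap.mulRight_apply, LinearMap.coe_mk, AddHom.coe_mk,
      Pi.mul_apply, Pi.sub_apply, Pi.smul_apply, smul_eq_mul, he.2.2]
    ring
  | add a b ha hb =>
    rw [map_add, map_add, LinearMap.add_apply, add_smul, add_sub_add_comm]
    exact add_mem ha hb
  | smul c a ha =>
    rw [map_smul, map_smul, LinearMap.smul_apply, smul_assoc, ← smul_sub]
    exact Submodule.smul_mem _ _ ha

/-- Each factor from the kernel of the character lowers the degree index of p by one. -/
theorem groupAlgebraRep_eq_zero_of_mem_ker_pow {e : G → ℂ} (he : IsExponential e) {n : ℕ}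
    {p : G → ℂ} (hp : p ∈ differenceDegree G n) {a : AddMonoidAlgebra ℂ G}
    (ha : a ∈ RingHom.ker he.character ^ n) :
    groupAlgebraRep (translateFunHom G) a (p * e) = 0 := by
  induction n generalizing p a with
  | zero => rw [show p = 0 from hp, zero_mul, map_zero]
  | succ n ih =>
    rw [pow_succ] at ha
    induction ha using Submodule.mul_induction_on' with
    | mem_mul_mem c hc b hb =>
      have h := groupAlgebraRep_sub_character_mem he hp b
      rw [show he.character b = 0 from hb, zero_smul, sub_zero] at h
      obtain ⟨p', hp', h⟩ := h
      rw [groupAlgebraRep_mul_apply, ← h]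
      exact ih hp' hc
    | add a _ b _ ha hb => rw [map_add, LinearMap.add_apply, ha, hb, add_zero]

/-- The exponentials of a reduced form are characters of the orbit algebra. -/
theorem IsReducedForm.exists_character {N : ℕ} {p e : Fin N → G → ℂ} (h : IsReducedForm p e)
    {f : G → ℂ} (hf : ∀ x, f x = ∑ i, p i x * e i x) (l : Fin N) :
    ∃ χ : OrbitAlgebra (translateFunHom G) f →ₐ[ℂ] ℂ,
      ∀ x, χ (OrbitAlgebra.point (translateFunHom G) f x) = e l x := by
  classical
  have he := h.exponential
  suffices hle : ∀ a ∈ annihilatorOf (translateFunHom G) f, (he l).character a = 0 from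
    ⟨Ideal.Quotient.liftₐ _ (he l).character hle, fun x => (he l).character_single x⟩
  intro a ha
  by_contra hal
  choose n hn using fun i => exists_mem_differenceDegree
    (isPolynomialFun_iff_mem_polyFun.1 (h.polynomial i))
  have hc : ∀ i, ∃ c, c ∈ RingHom.ker (he i).character ∧ (i ≠ l → (he l).character c ≠ 0) := by
    intro i
    by_cases hil : i = l
    · exact ⟨0, zero_mem _, fun h => absurd hil h⟩
    · obtain ⟨x, hx⟩ := Function.ne_iff.1 (fun hel => hil (h.injective hel))
      refine ⟨AddMonoidAlgebra.single x 1 - algebraMap ℂ _ (e i x), ?_, fun _ => ?_⟩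
      · rw [RingHom.mem_ker, map_sub, IsExponential.character_single, AlgHom.commutes]
        exact sub_self _
      · rw [map_sub, IsExponential.character_single, AlgHom.commutes]
        exact sub_ne_zero.2 (Ne.symm hx)
  choose c hcker hcl using hc
  -- The extra factors kill every term except the l-th, and a kills f; hence b kills p l * e l,
  -- while its value at the l-th character stays nonzero.
  set b := a * ∏ i ∈ Finset.univ.erase l, c i ^ n i with hb
  have hbl : (he l).character b ≠ 0 := by
    rw [hb, map_mul, map_prod]
    refine mul_ne_zero hal (Finset.prod_ne_zero_iff.2 fun i hi => ?_)
    rw [map_pow]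
    exact pow_ne_zero _ (hcl i (Finset.ne_of_mem_erase hi))
  have hbf : groupAlgebraRep (translateFunHom G) b f = 0 := by
    rw [hb, mul_comm, groupAlgebraRep_mul_apply,
      show groupAlgebraRep (translateFunHom G) a f = 0 from ha, map_zero]
  have hbi : ∀ i ∈ Finset.univ.erase l,
      groupAlgebraRep (translateFunHom G) b (p i * e i) = 0 := by
    intro i hi
    refine groupAlgebraRep_eq_zero_of_mem_ker_pow (he i) (hn i) ?_
    rw [hb, ← Finset.mul_prod_erase _ _ hi]
    exact Ideal.mul_mem_left _ _ (Ideal.mul_mem_right _ _ (Ideal.pow_mem_pow (hcker i) _))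
  have hfsum : f = ∑ i, p i * e i := by
    ext x
    simp [hf]
  have hbpl : groupAlgebraRep (translateFunHom G) b (p l * e l) = 0 := by
    rw [hfsum, map_sum, ← Finset.add_sum_erase _ _ (Finset.mem_univ l),
      Finset.sum_eq_zero hbi, add_zero] at hbf
    exact hbf
  -- On p l * e l the element κ − b is nilpotent and b acts as zero, so a power of the nonzero
  -- scalar κ acts as zero.
  set κ := algebraMap ℂ (AddMonoidAlgebra ℂ G) ((he l).character b) with hκ
  have hd : κ - b ∈ RingHom.ker (he l).character := by
    rw [RingHom.mem_ker, map_sub, hκ, AlgHom.commutes]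
    exact sub_self _
  have hd' := groupAlgebraRep_eq_zero_of_mem_ker_pow (he l) (hn l) (Ideal.pow_mem_pow hd (n l))
  obtain ⟨w, hw⟩ := sub_dvd_pow_sub_pow κ (κ - b) (n l)
  rw [sub_sub_cancel] at hw
  have hκ0 : groupAlgebraRep (translateFunHom G) (κ ^ n l) (p l * e l) = 0 := by
    rw [← sub_add_cancel (κ ^ n l) ((κ - b) ^ n l), map_add, LinearMap.add_apply, hd', hw,
      mul_comm, groupAlgebraRep_mul_apply, hbpl, map_zero, add_zero]
  rw [hκ, ← map_pow, AlgHom.commutes, Module.algebraMap_end_apply] at hκ0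
  have hpe := (smul_eq_zero.1 hκ0).resolve_left (pow_ne_zero _ hbl)
  refine h.ne_zero l (funext fun x => ?_)
  exact (mul_eq_zero.1 (congrFun hpe x)).resolve_right ((he l).2.1 x)

end FunctionTranslations

/-! ### The theorem for continuous functions. -/

section FunctionTheorem

theorem evaluation_separates {G : Type*} (f : G → ℂ)
    (h : ∀ ℓ ∈ Set.range (fun x : G => (LinearMap.proj x : (G → ℂ) →ₗ[ℂ] ℂ)), ℓ f = 0) : f = 0 :=
  funext fun x => h _ ⟨x, rfl⟩

theorem OrbitAlgebra.point_character_injective {G E : Type*} [AddCommGroup G] [AddCommGroup E] [Module ℂ E]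
    (T : Multiplicative G →* Module.End ℂ E) (e : E) :
    Function.Injective
      (fun (χ : OrbitAlgebra T e →ₐ[ℂ] ℂ) (x : G) => χ (OrbitAlgebra.point T e x)) := by
  intro χ χ' h
  refine AlgHom.toLinearMap_injective (LinearMap.ext_on (OrbitAlgebra.span_range_point T e) ?_)
  rintro _ ⟨x, rfl⟩
  exact congrFun h x

variable {G : Type*} [AddCommGroup G] [TopologicalSpace G]

theorem exists_isReducedForm_of_sum {ι : Type*} [Fintype ι] {p e : ι → G → ℂ}
    (hp : ∀ i, p i ∈ polyFun G) (he : ∀ i, IsExponential (e i)) (hinj : Function.Injective e)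
    {f : G → ℂ} (hf : ∀ x, f x = ∑ i, p i x * e i x) :
    ∃ (N : ℕ) (p e : Fin N → G → ℂ), IsReducedForm p e ∧ ∀ x, f x = ∑ i, p i x * e i x := by
  classical
  let s := Finset.univ.filter fun i => p i ≠ 0
  let ψ : Fin s.card ≃ s := s.equivFin.symm
  refine ⟨s.card, fun j => p (ψ j), fun j => e (ψ j),
    ⟨fun j => isPolynomialFun_iff_mem_polyFun.2 (hp _), fun j => (Finset.mem_filter.1 (ψ j).2).2,
      fun j => he _, hinj.comp (Subtype.val_injective.comp ψ.injective)⟩, fun x => ?_⟩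
  rw [hf, ψ.sum_comp (fun i : s => p i x * e i x), Finset.sum_coe_sort s fun i => p i x * e i x]
  refine (Finset.sum_subset (Finset.subset_univ s) fun i _ hi => ?_).symm
  have : p i = 0 := by simpa [s] using hi
  rw [this, Pi.zero_apply, zero_mul]

variable [ContinuousAdd G]

theorem continuous_evaluation_translate {f : G → ℂ} (hf : Continuous f) :
    ∀ ℓ ∈ Set.range (fun x : G => (LinearMap.proj x : (G → ℂ) →ₗ[ℂ] ℂ)),
      Continuous fun x => ℓ (translateFunHom G (Multiplicative.ofAdd x) f) := by
  rintro _ ⟨y, rfl⟩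
  exact hf.comp (continuous_const.add continuous_id)

variable {r t : ℕ} {g : Fin t → G} {n : Fin r → Fin t → ℕ} {φ : Fin r → G → ℂ} {f : G → ℂ}

/-- A continuous function satisfying the mixed equation at topological generators is an exponential
polynomial. -/
theorem exists_isReducedForm_of_nodeDiff
    (hg : Dense (AddSubgroup.closure (Set.range g) : Set G)) (hf0 : f ≠ 0) (hf : Continuous f)
    (h : ∀ i, nodeDiff translateFun g n φ i f = 0) :
    ∃ (N : ℕ) (p e : Fin N → G → ℂ), IsReducedForm p e ∧ ∀ x, f x = ∑ i, p i x * e i x := by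
  let T := translateFunHom G
  have hfin : FiniteDimensional ℂ (OrbitAlgebra T f) :=
    OrbitAlgebra.finiteDimensional_of_nodeDiff T evaluation_separates
      (continuous_evaluation_translate hf) hg h
  have hc := OrbitAlgebra.coordinatesIn_contFun_point T evaluation_separates
    (continuous_evaluation_translate hf)
  have := OrbitAlgebra.nontrivial T hf0
  have := Fintype.ofFinite (OrbitAlgebra T f →ₐ[ℂ] ℂ)
  -- f(x) is the value at 0 of the translate of f by x, hence a matrix coefficient.
  obtain ⟨p, hp, hsum⟩ := exists_exponential_decomposition (OrbitAlgebra.point_zero T f)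
    (OrbitAlgebra.point_add T f) hc ((LinearMap.proj 0).comp (OrbitAlgebra.orbitMap T f))
  refine exists_isReducedForm_of_sum hp
    (fun χ => isExponential_character (OrbitAlgebra.point_zero T f)
      (OrbitAlgebra.point_add T f) hc χ)
    (OrbitAlgebra.point_character_injective T f) fun x => ?_
  rw [← hsum, LinearMap.comp_apply, OrbitAlgebra.orbitMap_point]
  simp [T, translateFunHom_ofAdd, translateFun]

omit [TopologicalSpace G] [ContinuousAdd G] in
theorem OrbitAlgebra.mixed_finRange_eq {E : Type*} [AddCommGroup E] [Module ℂ E]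
    (T : Multiplicative G →* Module.End ℂ E) (e : E) (m : Fin r → ℕ) (y : Fin r → G) (k : Fin r) :
    OrbitAlgebra.mixed T e φ m y (List.finRange r) =
      OrbitAlgebra.mixed T e φ m y ((List.finRange r).filter (· ≠ k)) *
        (OrbitAlgebra.point T e (y k) - algebraMap ℂ _ (φ k (y k))) ^ (m k + 1) := by
  classical
  rw [OrbitAlgebra.mixed, OrbitAlgebra.mixed,
    ← List.prod_toFinset _ ((List.nodup_finRange r).filter _), ← Fin.prod_univ_def,
    ← Finset.prod_erase_mul _ _ (Finset.mem_univ k)]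
  congr 2
  ext j
  simp

omit [TopologicalSpace G] [ContinuousAdd G] in
theorem OrbitAlgebra.mixed_filter_congr {E : Type*} [AddCommGroup E] [Module ℂ E]
    (T : Multiplicative G →* Module.End ℂ E) (e : E) (m : Fin r → ℕ) {y y' : Fin r → G} (k : Fin r)
    {m' : Fin r → ℕ} (hy : ∀ j ≠ k, y j = y' j) (hm : ∀ j ≠ k, m j = m' j) :
    OrbitAlgebra.mixed T e φ m y ((List.finRange r).filter (· ≠ k)) =
      OrbitAlgebra.mixed T e φ m' y' ((List.finRange r).filter (· ≠ k)) := by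
  rw [OrbitAlgebra.mixed, OrbitAlgebra.mixed]
  congr 1
  refine List.map_congr_left fun j hj => ?_
  have hjk : j ≠ k := by simpa using hj
  rw [hy j hjk, hm j hjk]

omit [TopologicalSpace G] [ContinuousAdd G] in
/-- Minimality yields a nonzero element on which the `k`-th factors of the mixed equations are
nilpotent. -/
theorem OrbitAlgebra.exists_ne_zero_mul_eq_zero {E : Type*} [AddCommGroup E] [Module ℂ E]
    (T : Multiplicative G →* Module.End ℂ E) {e : E} (he : e ≠ 0)
    (h : ∀ i, nodeDiff (fun x => T (Multiplicative.ofAdd x)) g n φ i e = 0) (k : Fin r)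
    (hmin : r = 1 ∨ ∃ a, nodeDiffOmit (fun x => T (Multiplicative.ofAdd x)) g n φ k a e ≠ 0) :
    ∃ q : OrbitAlgebra T e, q ≠ 0 ∧
      (∀ i, q * (OrbitAlgebra.point T e (g i) - algebraMap ℂ _ (φ k (g i))) ^ (n k i + 1) = 0) ∧
      ∀ n' : Fin r → ℕ,
        (∀ y, mixedDiff (fun x => T (Multiplicative.ofAdd x)) φ n' y (List.finRange r) e = 0) →
        (∀ k i, n' k ≤ n k i) →
        ∀ y, q * (OrbitAlgebra.point T e y - algebraMap ℂ _ (φ k y)) ^ (n' k + 1) = 0 := by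
  have := OrbitAlgebra.nontrivial T he
  rcases hmin with rfl | ⟨a, ha⟩
  · obtain rfl := Subsingleton.elim k 0
    have hnil : (List.finRange 1).filter (· ≠ (0 : Fin 1)) = [] := by decide
    refine ⟨1, one_ne_zero, fun i => ?_, fun n' hn' _ y => ?_⟩
    · have := (OrbitAlgebra.mixed_eq_zero_iff T e).2 (h fun _ => i)
      rw [OrbitAlgebra.mixed_finRange_eq T e _ _ 0, hnil] at this
      simpa [OrbitAlgebra.mixed] using this
    · have := (OrbitAlgebra.mixed_eq_zero_iff T e).2 (hn' fun _ => y)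
      rw [OrbitAlgebra.mixed_finRange_eq T e _ _ 0, hnil] at this
      simpa [OrbitAlgebra.mixed] using this
  -- The witness is the omitted product itself. Changing only the k-th index of a leaves it
  -- unchanged and multiplies it by any desired k-th factor.
  · refine ⟨OrbitAlgebra.mixed T e φ (fun j => n j (a j)) (fun j => g (a j))
      ((List.finRange r).filter (· ≠ k)), fun h0 => ha ((OrbitAlgebra.mixed_eq_zero_iff T e).1 h0),
      fun i => ?_, fun n' hn' hle y => ?_⟩
    · have := (OrbitAlgebra.mixed_eq_zero_iff T e).2 (h (Function.update a k i))
      rw [OrbitAlgebra.mixed_finRange_eq T e _ _ k,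
        OrbitAlgebra.mixed_filter_congr T e (m' := fun j => n j (a j)) (y' := fun j => g (a j))] at this
      · simpa using this
      · intro j hj
        simp [hj]
      · intro j hj
        simp [hj]
    · have := (OrbitAlgebra.mixed_eq_zero_iff T e).2
        (hn' (Function.update (fun j => g (a j)) k y))
      rw [OrbitAlgebra.mixed_finRange_eq T e _ _ k,
        OrbitAlgebra.mixed_filter_congr T e (m' := n') (y' := fun j => g (a j))
          _ _ (fun j hj => by simp [hj]) fun _ _ => rfl] at this
      simp only [Function.update_self] at this
      -- Since n' ≤ n, the omitted product with exponents n' divides the witness, which inherits its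
      -- annihilators.
      have hdvd : OrbitAlgebra.mixed T e φ n' (fun j => g (a j))
          ((List.finRange r).filter (· ≠ k)) ∣
          OrbitAlgebra.mixed T e φ (fun j => n j (a j)) (fun j => g (a j))
            ((List.finRange r).filter (· ≠ k)) := by
        classical
        rw [OrbitAlgebra.mixed, OrbitAlgebra.mixed,
          ← List.prod_toFinset _ ((List.nodup_finRange r).filter _),
          ← List.prod_toFinset _ ((List.nodup_finRange r).filter _)]
        exact Finset.prod_dvd_prod_of_dvd _ _ fun j _ =>
          pow_dvd_pow _ (Nat.succ_le_succ (hle j (a j)))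
      obtain ⟨w, hw⟩ := hdvd
      rw [hw, mul_right_comm, this, zero_mul]

omit [ContinuousAdd G] in
theorem IsExponential.eq_of_eq_on_nodes {e e' : G → ℂ} (he : IsExponential e)
    (he' : IsExponential e') (hg : Dense (AddSubgroup.closure (Set.range g) : Set G))
    (h : ∀ i, e (g i) = e' (g i)) : e = e' := by
  refine Continuous.ext_on hg he.1 he'.1 fun x hx => ?_
  induction hx using AddSubgroup.closure_induction with
  | mem x hx =>
    obtain ⟨i, rfl⟩ := hx
    exact h i
  | zero => rw [he.map_zero, he'.map_zero]
  | add x y _ _ hx hy => rw [he.2.2, he'.2.2, hx, hy]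
  | neg x _ hx =>
    have h1 := he.2.2 x (-x)
    have h2 := he'.2.2 x (-x)
    rw [add_neg_cancel, he.map_zero] at h1
    rw [add_neg_cancel, he'.map_zero, ← hx] at h2
    exact mul_left_cancel₀ (he.2.1 x) (h1.symm.trans h2)

/-- This turns an injective choice of indices into the renumbering demanded by the theorem. -/
theorem exists_perm_castLE {N r : ℕ} {j : Fin N → Fin r} (hj : Function.Injective j) :
    ∃ (hN : N ≤ r) (σ : Equiv.Perm (Fin r)), ∀ k, σ (Fin.castLE hN k) = j k := by
  classical
  have hN : N ≤ r := by simpa using Fintype.card_le_of_injective j hj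
  have hinj := Fin.castLE_injective hN
  let ε : {x // x ∈ Set.range (Fin.castLE hN)} ≃ {x // x ∈ Set.range j} :=
    (Equiv.ofInjective _ hinj).symm.trans (Equiv.ofInjective j hj)
  refine ⟨hN, ε.extendSubtype, fun k => ?_⟩
  rw [Equiv.extendSubtype_apply_of_mem _ _ ⟨k, rfl⟩]
  have : (Equiv.ofInjective _ hinj).symm ⟨Fin.castLE hN k, k, rfl⟩ = k :=
    Equiv.ofInjective_symm_apply hinj k
  simp only [ε, Equiv.trans_apply]
  rw [this]
  rfl

/-- The functions of a minimal set agree with exponentials at the nodes. -/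
theorem exists_exponential_of_minimal
    (hg : Dense (AddSubgroup.closure (Set.range g) : Set G)) (hf0 : f ≠ 0) (hf : Continuous f)
    (h : ∀ i, nodeDiff translateFun g n φ i f = 0)
    (hmin : ∀ k, r = 1 ∨ ∃ a, nodeDiffOmit translateFun g n φ k a f ≠ 0) :
    ∃ m : Fin r → G → ℂ, (∀ k, IsExponential (m k)) ∧ (∀ k i, m k (g i) = φ k (g i)) ∧
      ∀ n' : Fin r → ℕ,
        (∀ y : Fin r → G, mixedDiff translateFun φ n' y (List.finRange r) f = 0) →
        ((∀ k i, n' k ≤ n k i) → ∀ k, IsExponential (φ k)) ∧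
        ∀ (N : ℕ) (p e : Fin N → G → ℂ), IsReducedForm p e →
          (∀ x, f x = ∑ i, p i x * e i x) →
          ∃ (hN : N ≤ r) (σ : Equiv.Perm (Fin r)),
            ∀ (k : Fin N) (i : Fin t), e k (g i) = m (σ (Fin.castLE hN k)) (g i) := by
  let T := translateFunHom G
  have hfin : FiniteDimensional ℂ (OrbitAlgebra T f) :=
    OrbitAlgebra.finiteDimensional_of_nodeDiff T evaluation_separates
      (continuous_evaluation_translate hf) hg h
  have hc := OrbitAlgebra.coordinatesIn_contFun_point T evaluation_separates
    (continuous_evaluation_translate hf)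
  choose q hq0 hqg hqn using fun k => OrbitAlgebra.exists_ne_zero_mul_eq_zero T hf0 h k (hmin k)
  choose χ hχ using fun k => exists_character_of_mul_ne_zero (hq0 k)
  have hexp : ∀ k, IsExponential fun x => χ k (OrbitAlgebra.point T f x) := fun k =>
    isExponential_character (OrbitAlgebra.point_zero T f) (OrbitAlgebra.point_add T f) hc (χ k)
  have hval : ∀ k (y : G) (d : ℕ), q k * (OrbitAlgebra.point T f y -
      algebraMap ℂ _ (φ k y)) ^ (d + 1) = 0 → χ k (OrbitAlgebra.point T f y) = φ k y := by
    intro k y d hd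
    have := hχ k _ hd
    rw [map_pow, map_sub, AlgHom.commutes] at this
    exact sub_eq_zero.1 (pow_eq_zero_iff (Nat.succ_ne_zero d) |>.1 this)
  have hnode : ∀ k i, χ k (OrbitAlgebra.point T f (g i)) = φ k (g i) := fun k i =>
    hval k _ _ (hqg k i)
  refine ⟨fun k x => χ k (OrbitAlgebra.point T f x), hexp, hnode, fun n' hn' => ⟨?_, ?_⟩⟩
  · intro hle k
    have : φ k = fun x => χ k (OrbitAlgebra.point T f x) :=
      funext fun y => (hval k y _ (hqn k n' hn' hle y)).symm
    rw [this]
    exact hexp k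
  · intro N p e hpe hsum
    have key : ∀ l, ∃ k, ∀ i, e l (g i) = φ k (g i) := by
      intro l
      obtain ⟨ξ, hξ⟩ := hpe.exists_character hsum l
      -- If for each k some node b k separates e l from φ k, then ξ sends the equation with indices
      -- b to a product of nonzero numbers.
      by_contra! hcon
      choose b hb using hcon
      have := (OrbitAlgebra.mixed_eq_zero_iff T f).2 (h b)
      rw [OrbitAlgebra.mixed, ← Fin.prod_univ_def] at this
      have h1 := congrArg ξ this
      rw [map_prod, map_zero, Finset.prod_eq_zero_iff] at h1
      obtain ⟨k, -, hk⟩ := h1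
      rw [map_pow, map_sub, AlgHom.commutes] at hk
      refine hb k ?_
      rw [← hξ]
      exact sub_eq_zero.1 (pow_eq_zero_iff (Nat.succ_ne_zero _) |>.1 hk)
    choose j hj using key
    have hjinj : Function.Injective j := fun l l' hll => hpe.injective
      ((hpe.exponential l).eq_of_eq_on_nodes (hpe.exponential l') hg fun i => by
        rw [hj, hj, hll])
    obtain ⟨hN, σ, hσ⟩ := exists_perm_castLE hjinj
    exact ⟨hN, σ, fun l i => by rw [hσ, hj, ← hnode]⟩

end FunctionTheorem

/-! ### Extension of dominated functionals. -/

section Extension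

/-- A linear map dominated by the norm of another linear map factors through it continuously. -/
theorem exists_continuousLinearMap_comp_eq {M X : Type*} [AddCommGroup M] [Module ℝ M]
    [NormedAddCommGroup X] [NormedSpace ℝ X] (j : M →ₗ[ℝ] X) (v : M →ₗ[ℝ] ℂ) {C : ℝ}
    (h : ∀ m, ‖v m‖ ≤ C * ‖j m‖) : ∃ L : X →L[ℝ] ℂ, ∀ m, L (j m) = v m := by
  have hker : LinearMap.ker j ≤ LinearMap.ker v := fun m hm => by
    have := h m
    rw [LinearMap.mem_ker.1 hm, norm_zero, mul_zero] at this
    exact norm_le_zero_iff.1 this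
  let w : LinearMap.range j →ₗ[ℝ] ℂ :=
    (LinearMap.ker j).liftQ v hker ∘ₗ j.quotKerEquivRange.symm.toLinearMap
  have hw : ∀ m, w ⟨j m, m, rfl⟩ = v m := fun m => by
    have : j.quotKerEquivRange.symm ⟨j m, m, rfl⟩ = (LinearMap.ker j).mkQ m := by
      rw [LinearEquiv.symm_apply_eq]
      rfl
    simp only [w, LinearMap.comp_apply, LinearEquiv.coe_coe, this]
    rfl
  let w' : LinearMap.range j →L[ℝ] ℂ := w.mkContinuous C (by
    rintro ⟨_, m, rfl⟩
    rw [hw]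
    exact h m)
  obtain ⟨L, hL⟩ := w'.exist_extension_of_finiteDimensional_range
  refine ⟨L, fun m => ?_⟩
  rw [← hw m]
  exact (DFunLike.congr_fun hL ⟨j m, m, rfl⟩).symm

end Extension

/-! ### Finite order of distributions, through Banach spaces of jets. -/

section Jets

open BoundedContinuousFunction

variable {d : ℕ}

/-- The space of bounded continuous jets of order `k`. -/
def JetSpace (d k : ℕ) : Type :=
  (i : Fin (k + 1)) → (RSpace d →ᵇ (RSpace d [×(i : ℕ)]→L[ℝ] ℝ))

noncomputable instance (d k : ℕ) : NormedAddCommGroup (JetSpace d k) :=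
  Pi.normedAddCommGroup

noncomputable instance (d k : ℕ) : NormedSpace ℝ (JetSpace d k) :=
  Pi.normedSpace

instance (d k : ℕ) : CompleteSpace (JetSpace d k) :=
  Pi.complete _

/-- The component of order `i` of a jet, as a continuous linear map. -/
noncomputable def JetSpace.component (d k : ℕ) (i : Fin (k + 1)) :
    JetSpace d k →L[ℝ] (RSpace d →ᵇ (RSpace d [×(i : ℕ)]→L[ℝ] ℝ)) :=
  ContinuousLinearMap.proj (R := ℝ)
    (φ := fun i : Fin (k + 1) => RSpace d →ᵇ (RSpace d [×(i : ℕ)]→L[ℝ] ℝ)) i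

theorem Test.continuous_iteratedFDeriv (ψ : Test d) (i : ℕ) :
    Continuous (iteratedFDeriv ℝ i ψ) :=
  ψ.contDiff.continuous_iteratedFDeriv (by exact_mod_cast le_top)

/-- The derivative of order `i` of a test function, as a bounded continuous function. -/
noncomputable def Test.deriv (ψ : Test d) (i : ℕ) : RSpace d →ᵇ (RSpace d [×i]→L[ℝ] ℝ) :=
  BoundedContinuousFunction.ofNormedAddCommGroup (iteratedFDeriv ℝ i ψ)
    (ψ.continuous_iteratedFDeriv i)
    ((ψ.continuous_iteratedFDeriv i).bounded_above_of_compact_support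
      (ψ.hasCompactSupport.iteratedFDeriv i)).choose
    ((ψ.continuous_iteratedFDeriv i).bounded_above_of_compact_support
      (ψ.hasCompactSupport.iteratedFDeriv i)).choose_spec

/-- The jet of order `k` of a test function. -/
noncomputable def Test.jet (k : ℕ) (ψ : Test d) : JetSpace d k := fun i => ψ.deriv i

/-- Distributions have finite order on compact sets. -/
theorem exists_jet_extension (u : Distr d) (K : TopologicalSpace.Compacts (RSpace d)) :
    ∃ (k : ℕ) (L : JetSpace d k →L[ℝ] ℂ), ∀ ψ : Test d,
      (∀ x, ψ x ≠ 0 → x ∈ K) → u ψ = L (ψ.jet k) := by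
  let v : 𝓓^{⊤}_{K}(RSpace d, ℝ) →L[ℝ] ℂ :=
    u.comp (TestFunction.ofSupportedInCLM ℝ (Set.subset_univ _))
  obtain ⟨s, C, -, hC⟩ := Seminorm.bound_of_continuous
    (ContDiffMapSupportedIn.withSeminorms ℝ (RSpace d) ℝ ⊤ K)
    ((normSeminorm ℝ ℂ).comp v.toLinearMap) (continuous_norm.comp v.continuous)
  -- The highest derivative order among the finitely many seminorms that bound u on K.
  let k := s.sup id
  let j : 𝓓^{⊤}_{K}(RSpace d, ℝ) →ₗ[ℝ] JetSpace d k :=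
    LinearMap.pi (φ := fun i : Fin (k + 1) => RSpace d →ᵇ (RSpace d [×(i : ℕ)]→L[ℝ] ℝ)) fun i => ContDiffMapSupportedIn.structureMapLM ℝ ⊤ (i : ℕ)
  have hj : ∀ f, ‖v f‖ ≤ C * ‖j f‖ := fun f => by
    refine (hC f).trans ?_
    rw [_root_.smul_apply, NNReal.smul_def, smul_eq_mul]
    refine mul_le_mul_of_nonneg_left ?_ C.2
    refine Seminorm.finset_sup_apply_le (norm_nonneg _) fun i hi => ?_
    exact norm_le_pi_norm
      (G := fun i : Fin (k + 1) => RSpace d →ᵇ (RSpace d [×(i : ℕ)]→L[ℝ] ℝ)) (j f) ⟨i, Nat.lt_succ_of_le (Finset.le_sup (f := id) hi)⟩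
  obtain ⟨L, hL⟩ := exists_continuousLinearMap_comp_eq (X := JetSpace d k) (C := C) j
    (v : 𝓓^{⊤}_{K}(RSpace d, ℝ) →ₗ[ℝ] ℂ) hj
  refine ⟨k, L, fun ψ hψ => ?_⟩
  let f : 𝓓^{⊤}_{K}(RSpace d, ℝ) :=
    ContDiffMapSupportedIn.of_support_subset ψ.contDiff hψ
  have h1 : v f = u ψ := rfl
  have h2 : j f = ψ.jet k := by
    refine funext fun i => ?_
    ext1 x
    change ContDiffMapSupportedIn.structureMapLM ℝ ⊤ (i : ℕ) f x = _
    rw [ContDiffMapSupportedIn.structureMapLM_top_apply]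
    rfl
  rw [← h1, ← h2]
  exact (hL f).symm

theorem Test.jet_translate_apply (ψ : Test d) (y : RSpace d) (k : ℕ) (i : Fin (k + 1))
    (x : RSpace d) : (translateTestFun y ψ).jet k i x = iteratedFDeriv ℝ i ψ (x + y) := by
  change iteratedFDeriv ℝ i (fun x => ψ (x + y)) x = _
  rw [iteratedFDeriv_comp_add_right]

/-- Derivatives of a test function are uniformly continuous by compactness of support, so
translation is continuous in the sup norm of each jet component. -/
theorem Test.continuous_jet_translate (ψ : Test d) (k : ℕ) :
    Continuous fun x => (translateTestFun (-x) ψ).jet k := by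
  refine continuous_pi (A := fun i : Fin (k + 1) => RSpace d →ᵇ (RSpace d [×(i : ℕ)]→L[ℝ] ℝ))
    fun i => ?_
  have hu : UniformContinuous (iteratedFDeriv ℝ (i : ℕ) ψ) :=
    (ψ.hasCompactSupport.iteratedFDeriv i).uniformContinuous_of_continuous
      (ψ.continuous_iteratedFDeriv i)
  rw [Metric.continuous_iff]
  intro x₀ ε hε
  obtain ⟨δ, hδ, h⟩ := Metric.uniformContinuous_iff.1 hu (ε / 2) (half_pos hε)
  refine ⟨δ, hδ, fun x hx => lt_of_le_of_lt ?_ (half_lt_self hε)⟩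
  refine (BoundedContinuousFunction.dist_le (half_pos hε).le).2 fun z => ?_
  rw [Test.jet_translate_apply, Test.jet_translate_apply]
  refine (h ?_).le
  simpa [dist_comm] using hx

end Jets

/-! ### Distributions and convolution of test functions. -/

section Convolution

open MeasureTheory
open scoped Convolution Pointwise

variable {d : ℕ}

/-- The convolution of two test functions. -/
noncomputable def Test.conv (ρ η : Test d) : Test d where
  toFun := ρ ⋆[ContinuousLinearMap.lsmul ℝ ℝ, volume] η
  contDiff' := η.hasCompactSupport.contDiff_convolution_right _
    ρ.continuous.locallyIntegrable η.contDiff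
  hasCompactSupport' := ρ.hasCompactSupport.convolution _ η.hasCompactSupport
  tsupport_subset' := fun _ _ => trivial

theorem Test.conv_apply (ρ η : Test d) (x : RSpace d) :
    ρ.conv η x = ∫ y, ρ y * η (x - y) := rfl

theorem Test.conv_comm (ρ η : Test d) : ρ.conv η = η.conv ρ := by
  ext x
  rw [Test.conv_apply, Test.conv_apply, ← integral_sub_left_eq_self _ volume x]
  simp [mul_comm]

/-- All derivatives fall on η. This identifies the jet of a convolution with the Bochner integral of
the jets of translates. -/
theorem Test.iteratedFDeriv_conv (ρ η : Test d) (i : ℕ) (x : RSpace d) :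
    iteratedFDeriv ℝ i (ρ.conv η) x = ∫ y, ρ y • iteratedFDeriv ℝ i η (x - y) := by
  induction i generalizing x with
  | zero =>
    simp only [iteratedFDeriv_zero_eq_comp, Function.comp_apply, Test.conv_apply]
    rw [← LinearIsometryEquiv.coe_toContinuousLinearEquiv,
      ← ContinuousLinearEquiv.integral_comp_comm]
    refine integral_congr_ae (Filter.Eventually.of_forall fun y => ?_)
    ext
    simp
  | succ i ih =>
    have hη : ContDiff ℝ 1 (iteratedFDeriv ℝ i η) :=
      η.contDiff.iteratedFDeriv_right (by norm_cast; exact le_top)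
    have hc : iteratedFDeriv ℝ i (ρ.conv η) =
        ρ ⋆[ContinuousLinearMap.lsmul ℝ ℝ, volume] iteratedFDeriv ℝ i η := funext ih
    have hd := ((η.hasCompactSupport.iteratedFDeriv i).hasFDerivAt_convolution_right
      (ContinuousLinearMap.lsmul ℝ ℝ) (ρ.continuous.locallyIntegrable (μ := volume)) hη x).fderiv
    let I := (continuousMultilinearCurryLeftEquiv ℝ (fun _ : Fin (i + 1) => RSpace d) ℝ).symm
    rw [iteratedFDeriv_succ_eq_comp_left, Function.comp_apply, hc, hd, convolution_def]
    refine (ContinuousLinearEquiv.integral_comp_comm (𝕜 := ℝ) (μ := (volume : Measure (RSpace d)))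
      (E := RSpace d →L[ℝ] RSpace d [×i]→L[ℝ] ℝ) (F := RSpace d [×(i + 1)]→L[ℝ] ℝ)
      I.toContinuousLinearEquiv _).symm.trans ?_
    refine integral_congr_ae (Filter.Eventually.of_forall fun y => ?_)
    simp only [iteratedFDeriv_succ_eq_comp_left, Function.comp_apply]
    exact map_smul I (ρ y) (fderiv ℝ (iteratedFDeriv ℝ i η) (x - y))

/-- A distribution commutes with convolution integrals of test functions. -/
theorem apply_conv (u : Distr d) (ρ η : Test d) :
    u (ρ.conv η) = ∫ x, (ρ x : ℂ) * u (translateTestFun (-x) η) := by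
  -- K contains the supports of the convolution and of all translates of η by points of the support
  -- of ρ, so one order k and one functional L serve for all of them.
  let K : TopologicalSpace.Compacts (RSpace d) :=
    ⟨tsupport ρ + tsupport η, ρ.hasCompactSupport.isCompact.add η.hasCompactSupport.isCompact⟩
  obtain ⟨k, L, hL⟩ := exists_jet_extension u K
  have hΦ : Integrable fun x => ρ x • (translateTestFun (-x) η).jet k :=
    (ρ.continuous.smul (η.continuous_jet_translate k)).integrable_of_hasCompactSupport
      ρ.hasCompactSupport.smul_right
  have hjet : (ρ.conv η).jet k = ∫ x, ρ x • (translateTestFun (-x) η).jet k := by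
    refine funext fun i => ?_
    ext1 z
    let ev : JetSpace d k →L[ℝ] (RSpace d [×(i : ℕ)]→L[ℝ] ℝ) :=
      (BoundedContinuousFunction.evalCLM ℝ z).comp (JetSpace.component d k i)
    change _ = ev _
    rw [← ev.integral_comp_comm hΦ]
    change iteratedFDeriv ℝ i (ρ.conv η) z = _
    rw [Test.iteratedFDeriv_conv]
    refine integral_congr_ae (Filter.Eventually.of_forall fun y => ?_)
    simp only [map_smul]
    change _ = ρ y • (translateTestFun (-y) η).jet k i z
    rw [Test.jet_translate_apply, sub_eq_add_neg]
  have hsupp : ∀ x, ρ.conv η x ≠ 0 → x ∈ K := fun x hx => by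
    by_contra hxK
    refine hx ?_
    rw [Test.conv_apply]
    refine integral_eq_zero_of_ae (Filter.Eventually.of_forall fun y => ?_)
    by_contra hy
    exact hxK ⟨y, subset_tsupport _ (left_ne_zero_of_mul hy), x - y,
      subset_tsupport _ (right_ne_zero_of_mul hy), by simp⟩
  rw [hL _ hsupp, hjet, ← L.integral_comp_comm hΦ]
  refine integral_congr_ae (Filter.Eventually.of_forall fun x => ?_)
  by_cases hx : ρ x = 0
  · simp [hx]
  · simp only [map_smul, Complex.real_smul]
    rw [hL]
    intro z hz
    exact ⟨x, subset_tsupport _ hx, z + -x, subset_tsupport _ hz, by simp⟩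

/-- Translates by points near x₀ have supports in a common compact set, where u is a continuous
functional of the jet. -/
theorem continuous_apply_translate (u : Distr d) (ψ : Test d) :
    Continuous fun x => u (translateTestFun (-x) ψ) := by
  refine continuous_iff_continuousAt.2 fun x₀ => ?_
  let K : TopologicalSpace.Compacts (RSpace d) :=
    ⟨Metric.closedBall x₀ 1 + tsupport ψ,
      (isCompact_closedBall x₀ 1).add ψ.hasCompactSupport.isCompact⟩
  obtain ⟨k, L, hL⟩ := exists_jet_extension u K
  refine ((L.continuous.comp (ψ.continuous_jet_translate k)).continuousAt).congr ?_
  filter_upwards [Metric.closedBall_mem_nhds x₀ one_pos] with x hx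
  refine (hL _ fun z hz => ?_).symm
  exact ⟨x, hx, z + -x, subset_tsupport _ hz, by simp⟩

end Convolution

/-! ### From distributions to continuous densities. -/

section DistributionTranslations

open MeasureTheory

variable {d : ℕ}

theorem translateDistr_apply (y : RSpace d) (u : Distr d) (ψ : Test d) :
    translateDistr y u ψ = u (translateTestFun (-y) ψ) := rfl

/-- Translations of distributions as a representation. -/
noncomputable def translateDistrHom (d : ℕ) :
    Multiplicative (RSpace d) →* Module.End ℂ (Distr d) where
  toFun y := translateDistr y.toAdd
  map_one' := by
    ext u ψ
    rw [translateDistr_apply]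
    congr 1
    ext x
    change ψ (x + -(0 : RSpace d)) = ψ x
    rw [neg_zero, add_zero]
  map_mul' y z := by
    ext u ψ
    rw [Module.End.mul_apply, translateDistr_apply, translateDistr_apply, translateDistr_apply]
    congr 1
    ext x
    change ψ (x + -(y.toAdd + z.toAdd)) = ψ (x + -z.toAdd + -y.toAdd)
    rw [neg_add_rev, add_assoc]

/-- Evaluation of distributions at a test function. -/
noncomputable def evalTest (ψ : Test d) : Distr d →ₗ[ℂ] ℂ where
  toFun u := u ψ
  map_add' _ _ := rfl
  map_smul' _ _ := rfl

theorem evalTest_separates (u : Distr d)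
    (h : ∀ ℓ ∈ Set.range (evalTest (d := d)), ℓ u = 0) : u = 0 := by
  ext ψ
  exact h _ ⟨ψ, rfl⟩

theorem continuous_evalTest_translate (u : Distr d) : ∀ ℓ ∈ Set.range (evalTest (d := d)),
    Continuous fun x => ℓ (translateDistrHom d (Multiplicative.ofAdd x) u) := by
  rintro _ ⟨ψ, rfl⟩
  exact continuous_apply_translate u ψ

theorem OrbitAlgebra.orbitMap_mul_point {G E : Type*} [AddCommGroup G] [AddCommGroup E]
    [Module ℂ E] (T : Multiplicative G →* Module.End ℂ E) (e : E) (q : OrbitAlgebra T e) (x : G) :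
    OrbitAlgebra.orbitMap T e (q * OrbitAlgebra.point T e x) =
      T (Multiplicative.ofAdd x) (OrbitAlgebra.orbitMap T e q) := by
  obtain ⟨a, rfl⟩ := Ideal.Quotient.mk_surjective q
  rw [mul_comm, OrbitAlgebra.point, ← map_mul, OrbitAlgebra.orbitMap_mk,
    groupAlgebraRep_mul_apply, OrbitAlgebra.groupAlgebraRep_single, OrbitAlgebra.orbitMap_mk]

theorem Test.integrable_mul (ψ : Test d) {F : RSpace d → ℂ} (hF : Continuous F) :
    Integrable fun x => (ψ x : ℂ) * F x :=
  ((Complex.continuous_ofReal.comp ψ.continuous).mul hF).integrable_of_hasCompactSupport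
    (HasCompactSupport.mul_right (ψ.hasCompactSupport.comp_left Complex.ofReal_zero))

/-- Weak integral of a curve with continuous coordinates against a test function. -/
theorem exists_weak_integral {B : Type*} [CommRing B] [Algebra ℂ B] [FiniteDimensional ℂ B]
    {F : RSpace d → B} (hF : CoordinatesIn (contFun (RSpace d)) F) (ρ : Test d) :
    ∃ b : B, ∀ ℓ : B →ₗ[ℂ] ℂ, ℓ b = ∫ x, (ρ x : ℂ) * ℓ (F x) := by
  let β := Module.finBasis ℂ B
  refine ⟨∑ i, (∫ x, (ρ x : ℂ) * β.coord i (F x)) • β i, fun ℓ => ?_⟩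
  have h : ∀ x, (ρ x : ℂ) * ℓ (F x) = ∑ i, (ρ x : ℂ) * β.coord i (F x) * ℓ (β i) := fun x => by
    conv_lhs => rw [← β.sum_repr (F x)]
    simp only [map_sum, map_smul, smul_eq_mul, Finset.mul_sum, Module.Basis.coord_apply, mul_assoc]
  simp only [h, map_sum, map_smul, smul_eq_mul]
  rw [integral_finsetSum _ fun i _ => (ρ.integrable_mul (hF (β.coord i))).mul_const _]
  exact Finset.sum_congr rfl fun i _ => (integral_mul_const _ _).symm

theorem eq_zero_of_forall_integral_test_eq_zero {F : RSpace d → ℂ} (hF : Continuous F)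
    (h : ∀ ρ : Test d, ∫ x, (ρ x : ℂ) * F x = 0) : F = 0 := by
  have hae := ae_eq_zero_of_integral_contDiff_smul_eq_zero (μ := volume)
    hF.locallyIntegrable fun ρ hρ hρc => by
      simp only [Complex.real_smul]
      exact h ⟨ρ, hρ, hρc, fun _ _ => trivial⟩
  exact (Continuous.ae_eq_iff_eq volume hF continuous_zero).1 hae

/-- A distribution whose translates span a finite dimensional space is a continuous function. -/
theorem exists_continuous_eq_integral (u : Distr d)
    [FiniteDimensional ℂ (OrbitAlgebra (translateDistrHom d) u)] :
    ∃ F : RSpace d → ℂ, Continuous F ∧ ∀ ψ : Test d, u ψ = ∫ x, (ψ x : ℂ) * F x := by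
  let T := translateDistrHom d
  have hc := OrbitAlgebra.coordinatesIn_contFun_point T evalTest_separates
    (continuous_evalTest_translate u)
  let W : Submodule ℂ (OrbitAlgebra T u) :=
    { carrier := {q | ∃ F : RSpace d → ℂ, Continuous F ∧
        ∀ ψ : Test d, OrbitAlgebra.orbitMap T u q ψ = ∫ x, (ψ x : ℂ) * F x}
      add_mem' := by
        rintro q q' ⟨F, hF, h⟩ ⟨F', hF', h'⟩
        refine ⟨fun x => F x + F' x, hF.add hF', fun ψ => ?_⟩
        rw [map_add]
        change OrbitAlgebra.orbitMap T u q ψ + OrbitAlgebra.orbitMap T u q' ψ = _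
        simp only [mul_add]
        rw [h, h', integral_add (ψ.integrable_mul hF) (ψ.integrable_mul hF')]
      zero_mem' := ⟨fun _ => 0, continuous_const, fun ψ => by
        rw [map_zero]
        simp only [mul_zero, integral_zero]
        rfl⟩
      smul_mem' := by
        rintro c q ⟨F, hF, h⟩
        refine ⟨fun x => c * F x, continuous_const.mul hF, fun ψ => ?_⟩
        rw [map_smul]
        change c * OrbitAlgebra.orbitMap T u q ψ = _
        rw [h, ← integral_const_mul]
        simp only [mul_left_comm] }
  -- Regularizations of any element of the orbit lie in W. A functional m vanishing on W thus has ∫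
  -- ρ(x) m(q·π(x)) dx = 0 for every ρ, so m(q·π(x)) = 0 for all x, and x = 0 gives m(q) = 0.
  have hW : W = ⊤ := by
    by_contra hne
    obtain ⟨m, hm0, hm⟩ := Submodule.exists_dual_map_eq_bot_of_lt_top (lt_top_iff_ne_top.2 hne)
      inferInstance
    refine hm0 (LinearMap.ext fun q => ?_)
    have hcq : CoordinatesIn (contFun (RSpace d)) fun x => q * OrbitAlgebra.point T u x :=
      fun ℓ => hc (ℓ ∘ₗ LinearMap.mulLeft ℂ q)
    have hzero := eq_zero_of_forall_integral_test_eq_zero (hcq m) fun ρ => by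
      obtain ⟨b, hb⟩ := exists_weak_integral hcq ρ
      rw [← hb m]
      have hbW : b ∈ W := by
        refine ⟨fun x => OrbitAlgebra.orbitMap T u q (translateTestFun (-x) ρ),
          continuous_apply_translate _ ρ, fun ψ => ?_⟩
        have := hb (evalTest ψ ∘ₗ OrbitAlgebra.orbitMap T u)
        -- Commutativity of convolution moves the integration from ρ to ψ and exhibits the density.
        rw [← apply_conv, Test.conv_comm, apply_conv]
        refine this.trans (integral_congr_ae (Filter.Eventually.of_forall fun x => ?_))
        simp only [LinearMap.comp_apply, OrbitAlgebra.orbitMap_mul_point]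
        rfl
      have := Submodule.mem_map_of_mem (f := m) hbW
      rwa [hm, Submodule.mem_bot] at this
    have := congrFun hzero 0
    simpa [OrbitAlgebra.point_zero] using this
  have h1 : (1 : OrbitAlgebra T u) ∈ W := hW ▸ Submodule.mem_top
  obtain ⟨F, hF, h⟩ := h1
  refine ⟨F, hF, fun ψ => ?_⟩
  rw [← h, ← OrbitAlgebra.point_zero, OrbitAlgebra.orbitMap_point, ofAdd_zero, map_one]
  rfl

/-- The distribution `u` is integration against the continuous function `F`. -/
def IsContinuousDensity (u : Distr d) (F : RSpace d → ℂ) : Prop :=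
  Continuous F ∧ ∀ ψ : Test d, u ψ = ∫ x, (ψ x : ℂ) * F x

namespace IsContinuousDensity

variable {u u' : Distr d} {F F' : RSpace d → ℂ}

theorem translate (h : IsContinuousDensity u F) (y : RSpace d) :
    IsContinuousDensity (translateDistr y u) (translateFun y F) := by
  refine ⟨h.1.comp (continuous_id.add continuous_const), fun ψ => ?_⟩
  rw [translateDistr_apply, h.2, ← integral_add_right_eq_self _ y]
  refine integral_congr_ae (Filter.Eventually.of_forall fun x => ?_)
  change (ψ (x + y + -y) : ℂ) * F (x + y) = ψ x * F (x + y)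
  rw [add_neg_cancel_right]

theorem modDiff (h : IsContinuousDensity u F) (φ : RSpace d → ℂ) (y : RSpace d) :
    IsContinuousDensity (modDiff translateDistr φ y u) (modDiff translateFun φ y F) := by
  obtain ⟨hc, ht⟩ := h.translate y
  refine ⟨hc.sub (h.1.const_smul (φ y)), fun ψ => ?_⟩
  change translateDistr y u ψ - φ y * u ψ =
    ∫ x, (ψ x : ℂ) * (translateFun y F x - φ y * F x)
  rw [ht, h.2, ← integral_const_mul, ← integral_sub (ψ.integrable_mul hc)
    ((ψ.integrable_mul h.1).const_mul _)]
  refine integral_congr_ae (Filter.Eventually.of_forall fun x => ?_)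
  ring

theorem modDiff_pow (h : IsContinuousDensity u F) (φ : RSpace d → ℂ) (y : RSpace d) (n : ℕ) :
    IsContinuousDensity ((_root_.modDiff translateDistr φ y ^ n) u)
      ((_root_.modDiff translateFun φ y ^ n) F) := by
  induction n with
  | zero => exact h
  | succ n ih =>
    rw [pow_succ', pow_succ', Module.End.mul_apply, Module.End.mul_apply]
    exact ih.modDiff φ y

theorem mixedDiff (h : IsContinuousDensity u F) {r : ℕ} (φ : Fin r → RSpace d → ℂ) (n : Fin r → ℕ)
    (y : Fin r → RSpace d) (l : List (Fin r)) :
    IsContinuousDensity (mixedDiff translateDistr φ n y l u)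
      (mixedDiff translateFun φ n y l F) := by
  induction l with
  | nil => exact h
  | cons k l ih =>
    simp only [_root_.mixedDiff, List.map_cons, List.prod_cons, Module.End.mul_apply] at ih ⊢
    exact ih.modDiff_pow _ _ _

theorem eq_zero_iff (h : IsContinuousDensity u F) : u = 0 ↔ F = 0 := by
  constructor
  · rintro rfl
    exact eq_zero_of_forall_integral_test_eq_zero h.1 fun ψ => (h.2 ψ).symm
  · rintro rfl
    ext ψ
    rw [h.2]
    simp

theorem unique (h : IsContinuousDensity u F) (h' : IsContinuousDensity u F') : F = F' := by
  refine sub_eq_zero.1 (eq_zero_of_forall_integral_test_eq_zero (h.1.sub h'.1) fun ψ => ?_)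
  simp only [Pi.sub_apply, mul_sub]
  rw [integral_sub (ψ.integrable_mul h.1) (ψ.integrable_mul h'.1), ← h.2, ← h'.2, sub_self]

end IsContinuousDensity

end DistributionTranslations

/-! ### Assembly of the three cases. -/

theorem IsReducedForm.continuous_sum {G : Type*} [AddCommGroup G] [TopologicalSpace G] {N : ℕ}
    {p e : Fin N → G → ℂ} (h : IsReducedForm p e) : Continuous fun x => ∑ i, p i x * e i x :=
  continuous_finsetSum _ fun i _ =>
    (continuous_of_mem_polyFun (isPolynomialFun_iff_mem_polyFun.1 (h.polynomial i))).mul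
      (h.exponential i).1

theorem IsMinimalSet.eq_one_or_exists {G : Type*} [AddCommGroup G] {r t : ℕ} {g : Fin t → G}
    {n : Fin r → Fin t → ℕ} {φ : Fin r → G → ℂ} {f : G → ℂ} (h : IsMinimalSet g n φ f)
    (k : Fin r) : r = 1 ∨ ∃ a, nodeDiffOmit translateFun g n φ k a f ≠ 0 := by
  rcases h.2 with ⟨h1, -⟩ | ⟨-, h2⟩
  · exact Or.inl h1
  · obtain ⟨a, x, -, hx⟩ := h2 k
    exact Or.inr ⟨a, fun h0 => hx (congrFun h0 x)⟩

theorem theorem17 {r t : ℕ} (n : Fin r → Fin t → ℕ) :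
    -- (1) an Abelian group (with the discrete topology) generated by the nodes
    (∀ {G : Type*} [AddCommGroup G] [TopologicalSpace G] [DiscreteTopology G]
      (g : Fin t → G) (φ : Fin r → G → ℂ) (f : G → ℂ),
      AddSubgroup.closure (Set.range g) = ⊤ → f ≠ 0 →
      (∀ i : Fin r → Fin t, ∀ x, nodeDiff translateFun g n φ i f x = 0) →
      (∃ (N : ℕ) (p e : Fin N → G → ℂ), IsReducedForm p e ∧ ∀ x, f x = ∑ i, p i x * e i x) ∧
      (IsMinimalSet g n φ f →
        ∃ m : Fin r → G → ℂ, (∀ k, IsExponential (m k)) ∧ (∀ k i, m k (g i) = φ k (g i)) ∧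
          ∀ n' : Fin r → ℕ,
            (∀ (y : Fin r → G) (x : G),
              mixedDiff translateFun φ n' y (List.finRange r) f x = 0) →
            ((∀ k i, n' k ≤ n k i) → ∀ k, IsExponential (φ k)) ∧
            ∀ (N : ℕ) (p e : Fin N → G → ℂ), IsReducedForm p e →
              (∀ x, f x = ∑ i, p i x * e i x) →
              ∃ (hN : N ≤ r) (σ : Equiv.Perm (Fin r)),
                ∀ (k : Fin N) (i : Fin t), e k (g i) = m (σ (Fin.castLE hN k)) (g i))) ∧
    -- (2) a topological Abelian group in which the nodes generate a dense subgroup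
    (∀ {G : Type*} [AddCommGroup G] [TopologicalSpace G] [IsTopologicalAddGroup G]
      (g : Fin t → G) (φ : Fin r → G → ℂ) (f : G → ℂ),
      Dense (AddSubgroup.closure (Set.range g) : Set G) → f ≠ 0 → Continuous f →
      (∀ i : Fin r → Fin t, ∀ x, nodeDiff translateFun g n φ i f x = 0) →
      (∃ (N : ℕ) (p e : Fin N → G → ℂ), IsReducedForm p e ∧ ∀ x, f x = ∑ i, p i x * e i x) ∧
      (IsMinimalSet g n φ f →
        ∃ m : Fin r → G → ℂ, (∀ k, IsExponential (m k)) ∧ (∀ k i, m k (g i) = φ k (g i)) ∧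
          ∀ n' : Fin r → ℕ,
            (∀ (y : Fin r → G) (x : G),
              mixedDiff translateFun φ n' y (List.finRange r) f x = 0) →
            ((∀ k i, n' k ≤ n k i) → ∀ k, IsExponential (φ k)) ∧
            ∀ (N : ℕ) (p e : Fin N → G → ℂ), IsReducedForm p e →
              (∀ x, f x = ∑ i, p i x * e i x) →
              ∃ (hN : N ≤ r) (σ : Equiv.Perm (Fin r)),
                ∀ (k : Fin N) (i : Fin t), e k (g i) = m (σ (Fin.castLE hN k)) (g i))) ∧
    -- (3) distributions on `ℝ^d`, the nodes generating a dense subgroup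
    (∀ (d : ℕ) (g : Fin t → RSpace d) (φ : Fin r → RSpace d → ℂ) (u : Distr d),
      Dense (AddSubgroup.closure (Set.range g) : Set (RSpace d)) → u ≠ 0 →
      (∀ i : Fin r → Fin t, nodeDiff translateDistr g n φ i u = 0) →
      (∃ (N : ℕ) (p e : Fin N → RSpace d → ℂ), IsReducedForm p e ∧
        IsGivenBy u (fun x => ∑ i, p i x * e i x)) ∧
      (IsMinimalSetDistr g n φ u →
        ∃ m : Fin r → RSpace d → ℂ, (∀ k, IsExponential (m k)) ∧
          (∀ k i, m k (g i) = φ k (g i)) ∧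
          ∀ n' : Fin r → ℕ,
            (∀ y : Fin r → RSpace d,
              mixedDiff translateDistr φ n' y (List.finRange r) u = 0) →
            ((∀ k i, n' k ≤ n k i) → ∀ k, IsExponential (φ k)) ∧
            ∀ (N : ℕ) (p e : Fin N → RSpace d → ℂ), IsReducedForm p e →
              IsGivenBy u (fun x => ∑ i, p i x * e i x) →
              ∃ (hN : N ≤ r) (σ : Equiv.Perm (Fin r)),
                ∀ (k : Fin N) (i : Fin t), e k (g i) = m (σ (Fin.castLE hN k)) (g i))) := by
  refine ⟨?_, ?_, ?_⟩
  · intro G _ _ _ g φ f hg hf h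
    have hg' : Dense (AddSubgroup.closure (Set.range g) : Set G) := by
      rw [hg]
      exact dense_univ
    have h' : ∀ i, nodeDiff translateFun g n φ i f = 0 := fun i => funext (h i)
    refine ⟨exists_isReducedForm_of_nodeDiff hg' hf continuous_of_discreteTopology h',
      fun hmin => ?_⟩
    obtain ⟨m, hm, hmφ, hmn⟩ := exists_exponential_of_minimal hg' hf
      continuous_of_discreteTopology h' hmin.eq_one_or_exists
    exact ⟨m, hm, hmφ, fun n' hn' => hmn n' fun y => funext (hn' y)⟩
  · intro G _ _ _ g φ f hg hf hfc h
    have h' : ∀ i, nodeDiff translateFun g n φ i f = 0 := fun i => funext (h i)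
    refine ⟨exists_isReducedForm_of_nodeDiff hg hf hfc h', fun hmin => ?_⟩
    obtain ⟨m, hm, hmφ, hmn⟩ := exists_exponential_of_minimal hg hf hfc h' hmin.eq_one_or_exists
    exact ⟨m, hm, hmφ, fun n' hn' => hmn n' fun y => funext (hn' y)⟩
  · intro d g φ u hg hu h
    have hfin : FiniteDimensional ℂ (OrbitAlgebra (translateDistrHom d) u) :=
      OrbitAlgebra.finiteDimensional_of_nodeDiff (translateDistrHom d) evalTest_separates
        (continuous_evalTest_translate u) hg h
    obtain ⟨F, hF⟩ := exists_continuous_eq_integral u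
    have hF : IsContinuousDensity u F := hF
    have hF0 : F ≠ 0 := fun h0 => hu (hF.eq_zero_iff.2 h0)
    -- Difference operators act compatibly on u and on its density, and a continuous density
    -- vanishes exactly when the distribution does.
    have h' : ∀ i, nodeDiff translateFun g n φ i F = 0 := fun i =>
      (hF.mixedDiff _ _ _ _).eq_zero_iff.1 (h i)
    constructor
    · obtain ⟨N, p, e, hpe, hsum⟩ := exists_isReducedForm_of_nodeDiff hg hF0 hF.1 h'
      obtain rfl : F = fun x => ∑ i, p i x * e i x := funext hsum
      exact ⟨N, p, e, hpe, hF.1.locallyIntegrable, hF.2⟩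
    · intro hmin
      obtain ⟨m, hm, hmφ, hmn⟩ := exists_exponential_of_minimal hg hF0 hF.1 h' fun k => by
        rcases hmin.2 with ⟨h1, -⟩ | ⟨-, h2⟩
        · exact Or.inl h1
        · obtain ⟨a, ha⟩ := h2 k
          exact Or.inr ⟨a, fun h0 => ha ((hF.mixedDiff _ _ _ _).eq_zero_iff.2 h0)⟩
      refine ⟨m, hm, hmφ, fun n' hn' => ?_⟩
      obtain ⟨h1, h2⟩ := hmn n' fun y => (hF.mixedDiff _ _ _ _).eq_zero_iff.1 (hn' y)
      refine ⟨h1, fun N p e hpe hgiven => h2 N p e hpe fun x => ?_⟩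
      -- A reduced form is continuous, so it is the density F at every point and not only almost
      -- everywhere.
      exact congrFun (hF.unique ⟨hpe.continuous_sum, hgiven.2⟩) x
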